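/- Let $n\ge 0$ be an integer and let $X=(\mathbb{R}^n,\|\cdot\|)$, where $\|\cdot\|$ is a norm on $\mathbb{R}^n$ such that the closed Euclidean unit ball $B_2^n$ is an ellipsoid of maximal volume among the ellipsoids contained in the closed unit ball $B_X=\{x:\|x\|\le 1\}$ (an ellipsoid is the image of $B_2^n$ under an invertible affine map). A contact point of $B_X$ with $B_2^n$ is a vector $x$ with $\|x\|=\|x\|_2=1$. Then for every $\varepsilon\in(0,1)$ there exist an integer $k\ge(1-\varepsilon)^2n$ and contact points $x_1,\dots,x_k$ of $B_X$ with $B_2^n$ such that for all real $a_1,\dots,a_k$ $$\frac{\varepsilon}{2-\varepsilon}\Big(\sum_{j\le k}a_j^2\Big)^{1/2}\le\Big\|\sum_{j\le k}a_jx_j\Big\|_2\le\frac{2-\varepsilon}{\varepsilon}\Big(\sum_{j\le k}a_j^2\Big)^{1/2}.$$ Moreover, for the same $k$, there is a proportional Dvoretzky–Rogers factorization: there are linear maps $\alpha:\ell_2^k\to X$ and $\beta:X\to\ell_\infty^k$ such that $\beta\circ\alpha$ is the formal identity $\ell_2^k\to\ell_\infty^k$, $\|\alpha\|\le\frac{2-\varepsilon}{\varepsilon}$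 and $\|\beta\|\le1$. -/

import Mathlib

/-- An ellipsoid in `ℝⁿ`: the image of the closed Euclidean unit ball under an invertible affine
map. -/
def IsEllipsoid {n : ℕ} (E : Set (EuclideanSpace ℝ (Fin n))) : Prop :=
  ∃ (c : EuclideanSpace ℝ (Fin n))
    (T : EuclideanSpace ℝ (Fin n) ≃ₗ[ℝ] EuclideanSpace ℝ (Fin n)),
    E = (fun x => c + T x) '' Metric.closedBall 0 1

/-- `E` is an ellipsoid of maximal volume among all the ellipsoids contained in `K`. -/
def IsMaxVolumeEllipsoid {n : ℕ} (E K : Set (EuclideanSpace ℝ (Fin n))) : Prop :=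
  IsEllipsoid E ∧ E ⊆ K ∧
    ∀ F : Set (EuclideanSpace ℝ (Fin n)), IsEllipsoid F → F ⊆ K →
      MeasureTheory.volume F ≤ MeasureTheory.volume E

/-- `x` is a contact point of the unit ball of the norm `N` with the Euclidean unit ball: it lies
on both unit spheres. -/
def IsContactPoint {n : ℕ} (N : Seminorm ℝ (EuclideanSpace ℝ (Fin n)))
    (x : EuclideanSpace ℝ (Fin n)) : Prop :=
  N x = 1 ∧ ‖x‖ = 1

/-- The formal identity `ℓ₂ᵏ → ℓ_∞ᵏ` factors as `β ∘ α` through `(ℝⁿ, N)`, with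
`‖α : ℓ₂ᵏ → (ℝⁿ, N)‖ ≤ C` and `‖β : (ℝⁿ, N) → ℓ_∞ᵏ‖ ≤ 1`.
The norm of `Fin k → ℝ` is the supremum norm. -/
def HasDvoretzkyRogersFactorization {n : ℕ} (N : Seminorm ℝ (EuclideanSpace ℝ (Fin n)))
    (k : ℕ) (C : ℝ) : Prop :=
  ∃ (α : EuclideanSpace ℝ (Fin k) →ₗ[ℝ] EuclideanSpace ℝ (Fin n))
    (β : EuclideanSpace ℝ (Fin n) →ₗ[ℝ] (Fin k → ℝ)),
    (∀ (a : EuclideanSpace ℝ (Fin k)) (j : Fin k), β (α a) j = a j) ∧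
    (∀ a : EuclideanSpace ℝ (Fin k), N (α a) ≤ C * ‖a‖) ∧
    (∀ x : EuclideanSpace ℝ (Fin n), ‖β x‖ ≤ N x)

/-!
By maximality of the Euclidean ball, the contact points decompose the identity (John):
`∑ j, c j • v j ⊗ v j = 1` with `c j ≥ 0` and `∑ j, c j = n`
(`IsMaxVolumeEllipsoid.exists_decomposition`). Otherwise `n⁻¹ • 1` could be separated from the
convex hull of the `v ⊗ v`, which gives a matrix `H` with positive trace and `⟪v, H v⟫ < 0` at every
contact point; for small `t > 0` the ellipsoid `(1 + t H) B` would then lie in the unit ball of `N`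
and have determinant larger than one.

From this decomposition the vectors are selected one at a time by a barrier argument in the style of
Batson, Spielman and Srivastava. For the operator `A = ∑ x xᵀ` over the vectors selected so far, a
lower barrier `b` decreases and an upper barrier `u` increases at each step, the nonzero spectrum of
`A` stays in `(b, u)`, and the potentials `tr (A - b)⁻¹` and `tr (u - A)⁻¹` do not increase. All of
this is expressed through the Gram matrix `G` of the selected vectors, whose spectrum is the nonzero
spectrum of `A`: adding a vector borders `G` by a row and a column, and positivity and the trace of
the inverse of a bordered matrix are given by the Schur complement (`Matrix.PosDef.border`).

Each barrier `b`, `u` imposes a condition on the new vector, `lowerShift ≥ 1` and `upperShift ≤ 1`.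
The vectors cannot be rescaled, so both must hold at the same index. Put `β = (ε / (2 - ε))²`. With
the right barriers, the average of `lowerShift` is at least `β⁻¹` times the average of `upperShift`,
whence `lowerShift ≥ β⁻¹ * upperShift` at some index. As `b ≥ β` and `u ≤ β⁻¹` throughout,
`lowerShift ≤ β⁻¹` and `upperShift ≥ β` there, so both conditions follow
(`IsBarrierState.exists_step`). The barriers can move at least `⌈(1 - ε)² n⌉ - 1` times before
reaching `β` and `β⁻¹`; the last vector is obtained by moving them to `β` and `β⁻¹` exactly, with no
concern for the potentials (`IsBarrierState.exists_last_step`). This gives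
`exists_restricted_invertibility`.

For the factorization, contact points are norming functionals, so `z ↦ (⟪x j, z⟫)ⱼ` has norm at
most one from `N` to `ℓ_∞ᵏ`. Composing it with the synthesis map `X a = ∑ j, a j • x j` gives
the Gram operator `XᵀX`, so that `α = X (XᵀX)⁻¹` is a right inverse, whose norm is the inverse of
the smallest singular value of `X`.
-/

open scoped RealInnerProductSpace
open Filter Topology

/-! ### Convex hulls of compact sets -/

/-- In finite dimension the convex hull of a compact set is compact. -/
theorem IsCompact.isCompact_convexHull_of_finiteDimensional {V : Type*} [NormedAddCommGroup V]
    [NormedSpace ℝ V] [FiniteDimensional ℝ V] {S : Set V} (hS : IsCompact S) :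
    IsCompact (convexHull ℝ S) := by
  classical
  rcases S.eq_empty_or_nonempty with rfl | ⟨x₀, hx₀⟩
  · simp
  -- By Carathéodory's theorem, `d + 1` points suffice.
  set m := Module.finrank ℝ V + 1
  have himg : convexHull ℝ S = (fun q : (Fin m → ℝ) × (Fin m → V) => ∑ i, q.1 i • q.2 i) ''
      (stdSimplex ℝ (Fin m) ×ˢ Set.univ.pi fun _ => S) := by
    apply Set.Subset.antisymm
    · intro x hx
      obtain ⟨ι, _, z, w, hz, haff, hw, hw1, rfl⟩ := eq_pos_convex_span_of_mem_convexHull hx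
      have hcard : Fintype.card ι ≤ Fintype.card (Fin m) := by
        rw [Fintype.card_fin]
        exact (haff.card_le_finrank_succ).trans
          (Nat.succ_le_succ (Submodule.finrank_le _))
      obtain ⟨e⟩ := Function.Embedding.nonempty_of_card_le hcard
      refine ⟨(Function.extend e w 0, Function.extend e z fun _ => x₀), ⟨⟨?_, ?_⟩, ?_⟩, ?_⟩
      · intro i
        by_cases hi : ∃ a, e a = i
        · obtain ⟨a, rfl⟩ := hi
          simpa [e.injective.extend_apply] using (hw a).le
        · simp [Function.extend_apply' _ _ _ hi]
      · rw [← hw1]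
        refine (Fintype.sum_of_injective e e.injective _ _ (fun i hi => ?_) fun a => ?_).symm
        · exact Function.extend_apply' _ _ _ fun ⟨a, ha⟩ => hi ⟨a, ha⟩
        · exact (e.injective.extend_apply _ _ _).symm
      · intro i _
        by_cases hi : ∃ a, e a = i
        · obtain ⟨a, rfl⟩ := hi
          simpa [e.injective.extend_apply] using hz ⟨a, rfl⟩
        · simpa [Function.extend_apply' _ _ _ hi] using hx₀
      · refine (Fintype.sum_of_injective e e.injective _ _ (fun i hi => ?_) fun a => ?_).symm
        · have := Function.extend_apply' w (0 : Fin m → ℝ) i fun ⟨a, ha⟩ => hi ⟨a, ha⟩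
          simp [this]
        · simp [e.injective.extend_apply]
    · rintro _ ⟨⟨w, z⟩, ⟨⟨hw0, hw1⟩, hz⟩, rfl⟩
      exact (convex_convexHull ℝ S).sum_mem (fun i _ => hw0 i) hw1
        fun i _ => subset_convexHull ℝ S (hz i trivial)
  rw [himg]
  refine ((isCompact_stdSimplex ℝ (Fin m)).prod (isCompact_univ_pi fun _ => hS)).image ?_
  fun_prop

/-! ### Contact points -/

section Seminorm

variable {n : ℕ} {N : Seminorm ℝ (EuclideanSpace ℝ (Fin n))}

theorem Seminorm.le_norm_of_closedBall_subset
    (h : Metric.closedBall (0 : EuclideanSpace ℝ (Fin n)) 1 ⊆ N.closedBall 0 1)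
    (x : EuclideanSpace ℝ (Fin n)) : N x ≤ ‖x‖ := by
  rcases eq_or_ne x 0 with rfl | hx
  · simp
  have hx' : 0 < ‖x‖ := norm_pos_iff.2 hx
  have h1 : ‖x‖⁻¹ • x ∈ N.closedBall 0 1 := h (by simp [norm_smul, hx'.ne'])
  rw [N.mem_closedBall_zero, map_smul_eq_mul, Real.norm_of_nonneg (by positivity),
    inv_mul_le_iff₀ hx'] at h1
  simpa using h1

theorem Seminorm.continuous_of_le_norm (hN : ∀ x, N x ≤ ‖x‖) : Continuous N :=
  (LipschitzWith.of_le_add fun x y => by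
    have h1 : N x ≤ N y + N (x - y) := by simpa using map_add_le_add N y (x - y)
    rw [dist_eq_norm]
    linarith [hN (x - y)]).continuous

/-- A contact point is its own supporting functional. -/
theorem IsContactPoint.abs_inner_le (hN : ∀ x, N x ≤ ‖x‖) {x : EuclideanSpace ℝ (Fin n)}
    (hx : IsContactPoint N x) (z : EuclideanSpace ℝ (Fin n)) : |⟪x, z⟫| ≤ N z := by
  have key : ∀ z : EuclideanSpace ℝ (Fin n), ⟪x, z⟫ ≤ N z := by
    intro z
    -- Compare the expansions of `‖x - s z‖²` and of `N` at `x` as `s` tends to zero.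
    have h1 : ∀ s : ℝ, 0 < s → ⟪x, z⟫ ≤ N z + s * (‖z‖ ^ 2 / 2) := by
      intro s hs
      have h2 : 1 ≤ ‖x - s • z‖ + s * N z := by
        have h3 := map_add_le_add N (x - s • z) (s • z)
        rw [sub_add_cancel, hx.1, map_smul_eq_mul, Real.norm_of_nonneg hs.le] at h3
        linarith [hN (x - s • z)]
      have h4 : ‖x - s • z‖ ^ 2 = 1 - 2 * s * ⟪x, z⟫ + s ^ 2 * ‖z‖ ^ 2 := by
        rw [norm_sub_sq_real, hx.2, inner_smul_right, norm_smul, Real.norm_of_nonneg hs.le]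
        ring
      have h5 : ‖x - s • z‖ ≤ (‖x - s • z‖ ^ 2 + 1) / 2 := by
        nlinarith [sq_nonneg (‖x - s • z‖ - 1)]
      have h6 : 0 ≤ s * (N z + s * (‖z‖ ^ 2 / 2) - ⟪x, z⟫) := by nlinarith
      have := nonneg_of_mul_nonneg_right h6 hs
      linarith
    have h2 : Tendsto (fun s : ℝ => N z + s * (‖z‖ ^ 2 / 2)) (𝓝[>] 0) (𝓝 (N z)) := by
      have : Continuous fun s : ℝ => N z + s * (‖z‖ ^ 2 / 2) := by fun_prop
      simpa using (this.tendsto 0).mono_left nhdsWithin_le_nhds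
    exact ge_of_tendsto h2 (eventually_mem_nhdsWithin.mono h1)
  refine abs_le.2 ⟨?_, key z⟩
  have := key (-z)
  rw [inner_neg_right, map_neg_eq_map] at this
  linarith

theorem isCompact_setOf_isContactPoint (hN : ∀ x, N x ≤ ‖x‖) :
    IsCompact {x | IsContactPoint N x} := by
  have hcont := N.continuous_of_le_norm hN
  have : {x | IsContactPoint N x} =
      Metric.sphere (0 : EuclideanSpace ℝ (Fin n)) 1 ∩ {x | N x = 1} := by
    ext x
    simp [IsContactPoint, and_comm]
  rw [this]
  exact (isCompact_sphere _ _).inter_right (isClosed_eq hcont continuous_const)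

/-- If a linear map `H` points inwards at every contact point, then `1 + t H` maps the
Euclidean unit sphere into the unit ball of `N` for all small `t > 0`. -/
theorem eventually_map_add_smul_le_one (hN : ∀ x, N x ≤ ‖x‖)
    (H : EuclideanSpace ℝ (Fin n) →ₗ[ℝ] EuclideanSpace ℝ (Fin n))
    (hH : ∀ x, IsContactPoint N x → ⟪x, H x⟫ < 0) :
    ∀ᶠ t in 𝓝[>] (0 : ℝ), ∀ y, ‖y‖ = 1 → N (y + t • H y) ≤ 1 := by
  by_contra hcon
  rw [not_eventually] at hcon
  obtain ⟨t, ht, hty⟩ := exists_seq_forall_of_frequently hcon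
  push Not at hty
  choose y hy1 hyN using hty
  have hHc : Continuous H := H.continuous_of_finiteDimensional
  have hNc := N.continuous_of_le_norm hN
  obtain ⟨z, hz, φ, hφ, hlim⟩ :=
    (isCompact_sphere (0 : EuclideanSpace ℝ (Fin n)) 1).tendsto_subseq
      (x := y) fun m => by simpa using hy1 m
  have hz1 : ‖z‖ = 1 := by simpa using hz
  -- By convexity of `s ↦ N (y + s H y)`, the inequality at `t` persists for larger parameters.
  have hge : ∀ s : ℝ, 0 < s → 1 ≤ N (z + s • H z) := by
    intro s hs
    have hc : Continuous fun x => N (x + s • H x) := by fun_prop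
    refine ge_of_tendsto ((hc.tendsto z).comp hlim) ?_
    have h1 : ∀ᶠ m in atTop, t (φ m) ∈ Set.Ioo 0 s :=
      (ht.comp hφ.tendsto_atTop).eventually (Ioo_mem_nhdsGT hs)
    refine h1.mono fun m hm => ?_
    simp only [Function.comp_apply]
    set x := y (φ m)
    set τ := t (φ m)
    have hx1 : ‖x‖ = 1 := hy1 _
    have hxN : 1 < N (x + τ • H x) := hyN _
    have hdec : x + τ • H x = (1 - τ / s) • x + (τ / s) • (x + s • H x) := by
      rw [smul_add, smul_smul, div_mul_cancel₀ _ hs.ne', sub_smul, one_smul]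
      abel
    have hτ : 0 < τ / s := div_pos hm.1 hs
    have hτ1 : τ / s < 1 := (div_lt_one hs).2 hm.2
    have h2 := map_add_le_add N ((1 - τ / s) • x) ((τ / s) • (x + s • H x))
    rw [← hdec, map_smul_eq_mul, map_smul_eq_mul, Real.norm_of_nonneg hτ.le,
      Real.norm_of_nonneg (by linarith)] at h2
    have h3 : N x ≤ 1 := hx1 ▸ hN x
    have h4 : (1 - τ / s) * N x ≤ (1 - τ / s) * 1 := mul_le_mul_of_nonneg_left h3 (by linarith)
    by_contra hlt
    push Not at hlt
    have h5 := mul_lt_mul_of_pos_left hlt hτ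
    linarith
  have hzc : IsContactPoint N z := by
    refine ⟨le_antisymm (hz1 ▸ hN z) ?_, hz1⟩
    have hc : Continuous fun s : ℝ => N (z + s • H z) := by fun_prop
    have h2 : Tendsto (fun s : ℝ => N (z + s • H z)) (𝓝[>] 0) (𝓝 (N z)) := by
      simpa using (hc.tendsto 0).mono_left nhdsWithin_le_nhds
    exact ge_of_tendsto h2 (eventually_mem_nhdsWithin.mono hge)
  have hneg := hH z hzc
  -- At a contact point the Euclidean norm of `z + s H z` is less than one for small `s`.
  have h1 : ∀ s : ℝ, 0 < s → 0 ≤ 2 * ⟪z, H z⟫ + s * ‖H z‖ ^ 2 := by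
    intro s hs
    have h2 : 1 ≤ ‖z + s • H z‖ := (hge s hs).trans (hN _)
    have h3 : ‖z + s • H z‖ ^ 2 = 1 + 2 * s * ⟪z, H z⟫ + s ^ 2 * ‖H z‖ ^ 2 := by
      rw [norm_add_sq_real, hz1, inner_smul_right, norm_smul, Real.norm_of_nonneg hs.le]
      ring
    have h4 : 0 ≤ s * (2 * ⟪z, H z⟫ + s * ‖H z‖ ^ 2) := by nlinarith
    exact nonneg_of_mul_nonneg_right h4 hs
  have h2 : Tendsto (fun s : ℝ => 2 * ⟪z, H z⟫ + s * ‖H z‖ ^ 2) (𝓝[>] 0)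
      (𝓝 (2 * ⟪z, H z⟫)) := by
    have : Continuous fun s : ℝ => 2 * ⟪z, H z⟫ + s * ‖H z‖ ^ 2 := by fun_prop
    simpa using (this.tendsto 0).mono_left nhdsWithin_le_nhds
  have := ge_of_tendsto h2 (eventually_mem_nhdsWithin.mono h1)
  linarith

end Seminorm

/-! ### John's decomposition of the identity -/

theorem Matrix.eventually_one_lt_det_one_add_smul {n : ℕ} {M : Matrix (Fin n) (Fin n) ℝ}
    (hM : 0 < M.trace) : ∀ᶠ t in 𝓝[>] (0 : ℝ), 1 < (1 + t • M).det := by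
  set q := ((1 + (Polynomial.X : Polynomial ℝ) • M.map Polynomial.C).det).divX.divX with hq
  have hc : Continuous fun t : ℝ => M.trace + q.eval t * t := by fun_prop
  have h1 : Tendsto (fun t : ℝ => M.trace + q.eval t * t) (𝓝[>] 0) (𝓝 M.trace) := by
    simpa using (hc.tendsto 0).mono_left nhdsWithin_le_nhds
  filter_upwards [h1.eventually (lt_mem_nhds hM), eventually_mem_nhdsWithin] with t ht ht0
  rw [Matrix.det_one_add_smul, ← hq]
  have := mul_pos (show 0 < t from ht0) ht
  nlinarith

/-- An ellipsoid of the form `(1 + t H) B` contradicts maximality as soon as `H` points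
inwards at every contact point and has positive trace. -/
theorem IsMaxVolumeEllipsoid.exists_contactPoint_of_trace_pos {n : ℕ}
    {N : Seminorm ℝ (EuclideanSpace ℝ (Fin n))}
    (hJohn : IsMaxVolumeEllipsoid (Metric.closedBall 0 1) (N.closedBall 0 1))
    {M : Matrix (Fin n) (Fin n) ℝ} (hM : 0 < M.trace) :
    ∃ x, IsContactPoint N x ∧ 0 ≤ ⟪x, M.toEuclideanLin x⟫ := by
  by_contra! hcon
  have hN := N.le_norm_of_closedBall_subset hJohn.2.1
  obtain ⟨t, ht1, ht2⟩ := ((eventually_map_add_smul_le_one hN M.toEuclideanLin hcon).and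
    (Matrix.eventually_one_lt_det_one_add_smul hM)).exists
  set T := (1 + t • M).toEuclideanLin with hT
  have hdet : LinearMap.det T = (1 + t • M).det := by
    rw [hT, Matrix.toEuclideanLin_eq_toLin_orthonormal, LinearMap.det_toLin]
  have hTx : ∀ x, T x = x + t • M.toEuclideanLin x := by
    intro x
    rw [hT, map_add, map_smul, LinearMap.add_apply, LinearMap.smul_apply]
    congr 1
    ext i
    simp
  have hunit : IsUnit (LinearMap.det T) := by
    rw [hdet]; exact (by linarith : (1 + t • M).det ≠ 0).isUnit
  let e := LinearEquiv.ofIsUnitDet (f := T) (v := (EuclideanSpace.basisFun (Fin n) ℝ).toBasis)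
    (v' := (EuclideanSpace.basisFun (Fin n) ℝ).toBasis)
    (by rw [LinearMap.det_toMatrix]; exact hunit)
  have he : ∀ x, e x = T x := fun x => rfl
  have hell : IsEllipsoid (T '' Metric.closedBall 0 1) :=
    ⟨0, e, by simp [he]⟩
  have hsub : T '' Metric.closedBall 0 1 ⊆ N.closedBall 0 1 := by
    rintro _ ⟨y, hy, rfl⟩
    rw [N.mem_closedBall_zero]
    rcases eq_or_ne y 0 with rfl | hy0
    · simp
    have hy0' : 0 < ‖y‖ := norm_pos_iff.2 hy0
    have h1 := ht1 (‖y‖⁻¹ • y) (by simp [norm_smul, hy0'.ne'])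
    rw [← hTx, map_smul, map_smul_eq_mul, Real.norm_of_nonneg (by positivity),
      inv_mul_le_iff₀ hy0'] at h1
    have : ‖y‖ ≤ 1 := by simpa using hy
    linarith
  have hvol := hJohn.2.2 _ hell hsub
  rw [MeasureTheory.Measure.addHaar_image_linearMap, hdet] at hvol
  have hpos : 0 < MeasureTheory.volume (Metric.closedBall (0 : EuclideanSpace ℝ (Fin n)) 1) :=
    Metric.measure_closedBall_pos _ _ one_pos
  have hfin : MeasureTheory.volume (Metric.closedBall (0 : EuclideanSpace ℝ (Fin n)) 1) ≠ ⊤ :=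
    (isCompact_closedBall _ _).measure_ne_top
  have hlt : (1 : ENNReal) < ENNReal.ofReal |(1 + t • M).det| := by
    rw [ENNReal.one_lt_ofReal]
    exact ht2.trans_le (le_abs_self _)
  have := (ENNReal.mul_lt_mul_iff_left hpos.ne' hfin).2 hlt
  rw [one_mul] at this
  exact absurd hvol (not_le.2 this)

/-- **John's decomposition of the identity.** -/
theorem IsMaxVolumeEllipsoid.exists_decomposition {n : ℕ} (hn : 0 < n)
    {N : Seminorm ℝ (EuclideanSpace ℝ (Fin n))}
    (hJohn : IsMaxVolumeEllipsoid (Metric.closedBall 0 1) (N.closedBall 0 1)) :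
    ∃ (J : Type) (_ : Fintype J) (c : J → ℝ) (v : J → EuclideanSpace ℝ (Fin n)),
      (∀ j, 0 ≤ c j) ∧ (∀ j, IsContactPoint N (v j)) ∧ ∑ j, c j = n ∧
      ∀ x y, ∑ j, c j * (⟪x, v j⟫ * ⟪v j, y⟫) = ⟪x, y⟫ := by
  have hN := N.le_norm_of_closedBall_subset hJohn.2.1
  have hn0 : (0 : ℝ) < n := by exact_mod_cast hn
  let g : EuclideanSpace ℝ (Fin n) → (Fin n → Fin n → ℝ) := fun x i j => x i * x j
  have hg : Continuous g := by fun_prop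
  have hcomp :=
    ((isCompact_setOf_isContactPoint hN).image hg).isCompact_convexHull_of_finiteDimensional
  set I : Fin n → Fin n → ℝ := fun i j => if i = j then (n : ℝ)⁻¹ else 0 with hI
  have hmem : I ∈ convexHull ℝ (g '' {x | IsContactPoint N x}) := by
    by_contra hnot
    obtain ⟨f, u, hfu, huI⟩ := geometric_hahn_banach_closed_point (convex_convexHull ℝ _)
      hcomp.isClosed hnot
    let M : Matrix (Fin n) (Fin n) ℝ := fun i j => f (Pi.single i (Pi.single j 1))
    have hf : ∀ A : Fin n → Fin n → ℝ, f A = ∑ i, ∑ j, A i j * M i j := by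
      intro A
      have hA : A = ∑ i, ∑ j, A i j • (Pi.single i (Pi.single j 1) : Fin n → Fin n → ℝ) := by
        ext a b
        simp [Finset.sum_apply, Pi.single_apply, ite_apply]
      conv_lhs => rw [hA]
      simp [map_sum, M]
    have htr : f I = (n : ℝ)⁻¹ * M.trace := by
      rw [hf, Matrix.trace, Finset.mul_sum]
      simp [hI]
    have hMt : 0 < (M - u • (1 : Matrix (Fin n) (Fin n) ℝ)).trace := by
      rw [Matrix.trace_sub, Matrix.trace_smul, Matrix.trace_one, Fintype.card_fin, smul_eq_mul]
      rw [htr, ← div_eq_inv_mul, lt_div_iff₀ hn0] at huI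
      linarith
    obtain ⟨x, hx, hx0⟩ := hJohn.exists_contactPoint_of_trace_pos hMt
    have h1 := hfu (g x) (subset_convexHull ℝ _ ⟨x, hx, rfl⟩)
    have h2 : ⟪x, M.toEuclideanLin x⟫ = f (g x) := by
      rw [hf, PiLp.inner_apply]
      refine Finset.sum_congr rfl fun i _ => ?_
      simp only [Matrix.toLpLin_apply, Matrix.mulVec, dotProduct, g,
        RCLike.inner_apply, conj_trivial, Finset.sum_mul]
      exact Finset.sum_congr rfl fun j _ => by ring
    have h3 : (u • (1 : Matrix (Fin n) (Fin n) ℝ)).toEuclideanLin x = u • x := by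
      ext i
      simp
    rw [map_sub, LinearMap.sub_apply, inner_sub_right, h2, h3, inner_smul_right,
      real_inner_self_eq_norm_sq, hx.2] at hx0
    linarith
  obtain ⟨J, _, z, w, hz, -, hw, hw1, hsum⟩ := eq_pos_convex_span_of_mem_convexHull hmem
  choose v hv hvz using fun j => hz ⟨j, rfl⟩
  refine ⟨J, inferInstance, fun j => n * w j, v, fun j => by have := hw j; positivity, hv, ?_, ?_⟩
  · rw [← Finset.mul_sum, hw1, mul_one]
  · intro x y
    have hab : ∀ a b, ∑ j, w j * (v j a * v j b) = I a b := by
      intro a b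
      rw [← hsum]
      simp [← hvz, g]
    calc ∑ j, n * w j * (⟪x, v j⟫ * ⟪v j, y⟫)
        = ∑ j, ∑ a, ∑ b, n * (x a * y b * (w j * (v j a * v j b))) := by
          refine Finset.sum_congr rfl fun j _ => ?_
          rw [PiLp.inner_apply, PiLp.inner_apply, Finset.sum_mul_sum, Finset.mul_sum]
          refine Finset.sum_congr rfl fun a _ => ?_
          rw [Finset.mul_sum]
          refine Finset.sum_congr rfl fun b _ => ?_
          simp only [RCLike.inner_apply, conj_trivial]
          ring
      _ = ∑ a, ∑ b, n * (x a * y b * I a b) := by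
          rw [Finset.sum_comm]
          refine Finset.sum_congr rfl fun a _ => ?_
          rw [Finset.sum_comm]
          refine Finset.sum_congr rfl fun b _ => ?_
          rw [← hab, Finset.mul_sum, Finset.mul_sum]
      _ = ⟪x, y⟫ := by
          rw [PiLp.inner_apply]
          refine Finset.sum_congr rfl fun a _ => ?_
          simp only [hI, mul_ite, mul_zero, Finset.sum_ite_eq, Finset.mem_univ, if_true,
            RCLike.inner_apply, conj_trivial]
          field_simp

/-! ### Bordered positive definite matrices -/

open Matrix in
/-- Bordering a positive definite matrix `P` by a vector `p` and a corner entry `r` keeps it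
positive definite if the Schur complement is positive; the trace of the inverse is explicit. -/
theorem Matrix.PosDef.border {ι : Type*} [Fintype ι] [DecidableEq ι] {P : Matrix ι ι ℝ}
    (hP : P.PosDef) (p : ι → ℝ) (r s : ℝ) (hs : r - p ⬝ᵥ P⁻¹ *ᵥ p = s) (hs0 : 0 < s) :
    (fromBlocks P (replicateCol Unit p) (replicateRow Unit p) (of fun _ _ => r)).PosDef ∧
    (fromBlocks P (replicateCol Unit p) (replicateRow Unit p) (of fun _ _ => r))⁻¹.trace =
      P⁻¹.trace + (1 + p ⬝ᵥ (P⁻¹ * P⁻¹) *ᵥ p) / s := by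
  have hdet : IsUnit P.det := (isUnit_iff_isUnit_det P).1 hP.isUnit
  have hPt : Pᵀ = P := by simpa [conjTranspose_eq_transpose_of_trivial] using hP.isHermitian.eq
  have hIt : P⁻¹ᵀ = P⁻¹ := by rw [transpose_nonsing_inv, hPt]
  set v := P⁻¹ *ᵥ p with hv
  have hPv : P *ᵥ v = p := by rw [hv, mulVec_mulVec, mul_nonsing_inv _ hdet, one_mulVec]
  have hpI : p ᵥ* P⁻¹ = v := by rw [hv, ← vecMul_transpose, hIt]
  have hvP : v ᵥ* P = p := by rw [← hPv, ← vecMul_transpose, hPt]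
  have hpv : p ⬝ᵥ v = r - s := by linarith
  constructor
  · refine PosDef.of_dotProduct_mulVec_pos ?_ ?_
    · refine IsHermitian.fromBlocks hP.isHermitian ?_ ?_
      · ext i j; simp
      · ext i j; simp
    · intro x hx
      obtain ⟨y, z, rfl⟩ : ∃ (y : ι → ℝ) (z : Unit → ℝ), x = Sum.elim y z :=
        ⟨x ∘ Sum.inl, x ∘ Sum.inr, (Sum.elim_comp_inl_inr x).symm⟩
      set t := z () with ht
      -- completing the square
      have key : star (Sum.elim y z) ⬝ᵥ (fromBlocks P (replicateCol Unit p)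
          (replicateRow Unit p) (of fun _ _ => r)) *ᵥ (Sum.elim y z) =
          (y + t • v) ⬝ᵥ P *ᵥ (y + t • v) + s * t ^ 2 := by
        have h1 : replicateCol Unit p *ᵥ z = t • p := by
          ext i; simp [mulVec, dotProduct, ht, mul_comm]
        have h3 : (of fun _ _ => r : Matrix Unit Unit ℝ) *ᵥ z = fun _ => r * t := by
          ext i; simp [mulVec, dotProduct, ht]
        have h2 : replicateRow Unit p *ᵥ y = fun _ => p ⬝ᵥ y := by
          ext i; simp [mulVec, dotProduct]
        rw [fromBlocks_mulVec]
        simp only [star_trivial, Sum.elim_comp_inl, Sum.elim_comp_inr, h1, h2, h3,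
          sumElim_dotProduct_sumElim, mulVec_add, mulVec_smul, hPv, dotProduct_add,
          add_dotProduct, dotProduct_smul, smul_dotProduct]
        have h4 : v ⬝ᵥ P *ᵥ y = p ⬝ᵥ y := by rw [dotProduct_mulVec, hvP]
        have h5 : z ⬝ᵥ ((fun _ => p ⬝ᵥ y) + fun _ => r * t) = t * (p ⬝ᵥ y + r * t) := by
          simp [dotProduct, ht]
        rw [← dotProduct_add, h5, h4, dotProduct_comm v p, hpv, dotProduct_comm y p]
        simp only [smul_eq_mul]
        ring
      rw [key]
      by_cases htz : t = 0
      · have hy : y ≠ 0 := by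
          rintro rfl
          apply hx
          ext i
          rcases i with i | i
          · rfl
          · exact htz
        simpa [htz] using hP.dotProduct_mulVec_pos hy
      · have h1 := hP.posSemidef.dotProduct_mulVec_nonneg (y + t • v)
        have h2 : 0 < s * t ^ 2 := by positivity
        rw [star_trivial] at h1
        linarith
  · have hinv : (fromBlocks P (replicateCol Unit p) (replicateRow Unit p) (of fun _ _ => r))⁻¹ =
        fromBlocks (P⁻¹ + s⁻¹ • vecMulVec v v) (replicateCol Unit (-s⁻¹ • v))
          (replicateRow Unit (-s⁻¹ • v)) (of fun _ _ => s⁻¹) := by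
      apply inv_eq_right_inv
      rw [fromBlocks_multiply, ← fromBlocks_one]
      congr 1
      · rw [Matrix.mul_add, mul_nonsing_inv _ hdet, Matrix.mul_smul, mul_vecMulVec, hPv]
        ext i j
        simp [mul_apply, vecMulVec_apply]
        ring
      · ext i j
        have := congrFun hPv i
        simp only [mulVec, dotProduct] at this
        simp only [add_apply, mul_apply, replicateCol_apply, Pi.smul_apply, smul_eq_mul,
          zero_apply, Finset.univ_unique, Finset.sum_singleton, of_apply]
        have h2 : ∑ j, P i j * (-s⁻¹ * v j) = -s⁻¹ * p i := by
          rw [← this, Finset.mul_sum]; exact Finset.sum_congr rfl fun _ _ => by ring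
        rw [h2]; ring
      · ext i j
        rw [Matrix.mul_add, Matrix.mul_smul, mul_vecMulVec]
        have h1 : (replicateRow Unit p * P⁻¹) i j = v j := by
          rw [← hpI]; simp [mul_apply, vecMul, dotProduct]
        have h2 : (replicateRow Unit p *ᵥ v) i = r - s := by
          rw [← hpv]; simp [mulVec, dotProduct]
        simp only [add_apply, h1, smul_apply, vecMulVec_apply, h2, mul_apply]
        simp
        field_simp
        ring
      · ext i j
        have h2 : ∑ j, p j * v j = r - s := hpv
        have h3 : ∑ j, p j * (-s⁻¹ * v j) = -s⁻¹ * (r - s) := by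
          rw [← h2, Finset.mul_sum]; exact Finset.sum_congr rfl fun _ _ => by ring
        simp [mul_apply] at h3 ⊢
        rw [h3]
        field_simp
        ring
    have htr : ∀ (A : Matrix ι ι ℝ) (B : Matrix ι Unit ℝ) (C : Matrix Unit ι ℝ)
        (D : Matrix Unit Unit ℝ), (fromBlocks A B C D).trace = A.trace + D.trace := by
      intro A B C D
      simp [trace]
    rw [hinv, htr, trace_add, trace_smul, trace_vecMulVec]
    have h1 : p ⬝ᵥ (P⁻¹ * P⁻¹) *ᵥ p = v ⬝ᵥ v := by
      rw [← mulVec_mulVec, dotProduct_mulVec, hpI]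
    rw [h1]
    simp [trace]
    field_simp
    ring

open Matrix in
/-- Decrease of the trace of the inverse under a shift, bounded below to first order. -/
theorem Matrix.PosDef.trace_inv_sub_trace_inv_add_smul_one {ι : Type*} [Fintype ι]
    [DecidableEq ι] {P : Matrix ι ι ℝ} (hP : P.PosDef) {δ : ℝ} (hδ : 0 < δ) :
    δ * ((P + δ • (1 : Matrix ι ι ℝ))⁻¹ * (P + δ • (1 : Matrix ι ι ℝ))⁻¹).trace ≤
      P⁻¹.trace - (P + δ • (1 : Matrix ι ι ℝ))⁻¹.trace := by
  have hP' : (P + δ • (1 : Matrix ι ι ℝ)).PosDef := hP.add (PosDef.one.smul hδ)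
  set Q := P + δ • (1 : Matrix ι ι ℝ) with hQ
  have hd : IsUnit P.det := (isUnit_iff_isUnit_det P).1 hP.isUnit
  have hd' : IsUnit Q.det := (isUnit_iff_isUnit_det Q).1 hP'.isUnit
  -- resolvent identity
  have h1 : P⁻¹ - Q⁻¹ = δ • (P⁻¹ * Q⁻¹) := by
    have : P⁻¹ * (Q - P) * Q⁻¹ = P⁻¹ - Q⁻¹ := by
      rw [mul_sub, sub_mul, nonsing_inv_mul _ hd, one_mul, mul_assoc, mul_nonsing_inv _ hd',
        mul_one]
    rw [← this, hQ]
    simp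
  have h2 : 0 ≤ (Q⁻¹ * P⁻¹ * Q⁻¹).trace := by
    have := (hP.inv.posSemidef.mul_mul_conjTranspose_same Q⁻¹).trace_nonneg
    rwa [hP'.inv.isHermitian.eq] at this
  have h3 : P⁻¹ * Q⁻¹ - Q⁻¹ * Q⁻¹ = δ • (P⁻¹ * Q⁻¹ * Q⁻¹) := by
    rw [← sub_mul, h1, smul_mul]
  have h4 := congrArg trace h3
  rw [trace_sub, trace_smul, trace_mul_cycle, smul_eq_mul] at h4
  have h5 := congrArg trace h1
  rw [trace_sub, trace_smul, smul_eq_mul] at h5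
  rw [h5]
  have := mul_nonneg hδ.le h2
  exact mul_le_mul_of_nonneg_left (by linarith) hδ.le

/-! ### Barrier potentials and averages of the shifts -/

open Matrix in
theorem Matrix.sum_smul_dotProduct_mulVec_eq_trace {ι J : Type*} [Fintype ι] [Fintype J]
    {G : Matrix ι ι ℝ} {c : J → ℝ} {p : J → ι → ℝ}
    (hG : ∑ j, c j • vecMulVec (p j) (p j) = G) (M : Matrix ι ι ℝ) :
    ∑ j, c j * (p j ⬝ᵥ M *ᵥ p j) = (M * G).trace := by
  rw [← hG, Matrix.mul_sum, trace_sum]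
  refine Finset.sum_congr rfl fun j _ => ?_
  rw [Matrix.mul_smul, trace_smul, mul_vecMulVec, trace_vecMulVec, smul_eq_mul,
    dotProduct_comm]

open Matrix in
theorem Matrix.trace_inv_mul_add_smul_one {ι : Type*} [Fintype ι] [DecidableEq ι]
    {Q : Matrix ι ι ℝ} (hQ : Q.PosDef) (σ z : ℝ) :
    (Q⁻¹ * (σ • Q + z • (1 : Matrix ι ι ℝ))).trace =
      σ * Fintype.card ι + z * Q⁻¹.trace := by
  have hd : IsUnit Q.det := (isUnit_iff_isUnit_det Q).1 hQ.isUnit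
  rw [Matrix.mul_add, Matrix.mul_smul, Matrix.mul_smul, nonsing_inv_mul _ hd, mul_one, trace_add,
    trace_smul, trace_smul, trace_one]
  simp

open Matrix in
theorem Matrix.trace_inv_mul_inv_mul_add_smul_one {ι : Type*} [Fintype ι] [DecidableEq ι]
    {Q : Matrix ι ι ℝ} (hQ : Q.PosDef) (σ z : ℝ) :
    (Q⁻¹ * Q⁻¹ * (σ • Q + z • (1 : Matrix ι ι ℝ))).trace =
      σ * Q⁻¹.trace + z * (Q⁻¹ * Q⁻¹).trace := by
  have hd : IsUnit Q.det := (isUnit_iff_isUnit_det Q).1 hQ.isUnit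
  rw [Matrix.mul_add, Matrix.mul_smul, Matrix.mul_smul, mul_assoc, nonsing_inv_mul _ hd, mul_one,
    mul_one, trace_add, trace_smul, trace_smul]
  simp

/-- The lower potential `tr (A - b)⁻¹`, for `A = ∑ i, xᵢ xᵢᵀ` in dimension `n`, written through
the Gram matrix `G` of the family `x`: besides the spectrum of `G`, the operator `A` has the
eigenvalue `0` with multiplicity `n - card ι`. -/
noncomputable def lowerPotential {ι : Type*} [Fintype ι] [DecidableEq ι] (n : ℝ)
    (G : Matrix ι ι ℝ) (b : ℝ) : ℝ :=
  (G - b • (1 : Matrix ι ι ℝ))⁻¹.trace - (n - Fintype.card ι) / b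

/-- The upper potential `tr (u - A)⁻¹`, for `A = ∑ i, xᵢ xᵢᵀ` in dimension `n`, written through
the Gram matrix `G` of the family `x`. -/
noncomputable def upperPotential {ι : Type*} [Fintype ι] [DecidableEq ι] (n : ℝ)
    (G : Matrix ι ι ℝ) (u : ℝ) : ℝ :=
  (u • (1 : Matrix ι ι ℝ) - G)⁻¹.trace + (n - Fintype.card ι) / u

open Matrix in
/-- The quantity `-wᵀ(A - b')⁻¹w - wᵀ(A - b')⁻²w / D`, for a unit vector `w` whose inner products
with the chosen family form the vector `p`, written through the Gram matrix `G`. If it is at least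
`1` and `D` is the decrease of the lower potential from `b` to `b'`, adding `w` to the family does
not increase the potential. -/
noncomputable def lowerShift {ι : Type*} [Fintype ι] [DecidableEq ι]
    (G : Matrix ι ι ℝ) (b' D : ℝ) (p : ι → ℝ) : ℝ :=
  (1 - p ⬝ᵥ (G - b' • (1 : Matrix ι ι ℝ))⁻¹ *ᵥ p) / b' -
    (1 - p ⬝ᵥ (G - b' • (1 : Matrix ι ι ℝ))⁻¹ *ᵥ p +
      b' * (p ⬝ᵥ ((G - b' • (1 : Matrix ι ι ℝ))⁻¹ * (G - b' • (1 : Matrix ι ι ℝ))⁻¹) *ᵥ p)) /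
      (b' ^ 2 * D)

open Matrix in
/-- The quantity `wᵀ(u' - A)⁻¹w + wᵀ(u' - A)⁻²w / D`, for a unit vector `w` whose inner products
with the chosen family form the vector `p`, written through the Gram matrix `G`. If it is at most
`1` and `D` is the decrease of the upper potential from `u` to `u'`, adding `w` to the family does
not increase the potential. -/
noncomputable def upperShift {ι : Type*} [Fintype ι] [DecidableEq ι]
    (G : Matrix ι ι ℝ) (u' D : ℝ) (p : ι → ℝ) : ℝ :=
  (1 + p ⬝ᵥ (u' • (1 : Matrix ι ι ℝ) - G)⁻¹ *ᵥ p) / u' +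
    (1 + p ⬝ᵥ (u' • (1 : Matrix ι ι ℝ) - G)⁻¹ *ᵥ p +
      u' * (p ⬝ᵥ ((u' • (1 : Matrix ι ι ℝ) - G)⁻¹ * (u' • (1 : Matrix ι ι ℝ) - G)⁻¹) *ᵥ p)) /
      (u' ^ 2 * D)

section Averages

open Matrix

variable {ι J : Type*} [Fintype ι] [DecidableEq ι] [Fintype J] {n : ℝ} {G : Matrix ι ι ℝ}
  {c : J → ℝ} {p : J → ι → ℝ}

theorem sum_lowerShift (hc : ∑ j, c j = n) (hG : ∑ j, c j • vecMulVec (p j) (p j) = G)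
    {b' : ℝ} (hb' : 0 < b') (hP : (G - b' • (1 : Matrix ι ι ℝ)).PosDef) (D : ℝ) :
    ∑ j, c j * lowerShift G b' D (p j) = -lowerPotential n G b' -
      ((n - Fintype.card ι) + b' ^ 2 *
        ((G - b' • (1 : Matrix ι ι ℝ))⁻¹ * (G - b' • (1 : Matrix ι ι ℝ))⁻¹).trace) /
        (b' ^ 2 * D) := by
  have hGQ : G = (1 : ℝ) • (G - b' • (1 : Matrix ι ι ℝ)) + b' • (1 : Matrix ι ι ℝ) := by simp
  have h1 := sum_smul_dotProduct_mulVec_eq_trace hG (G - b' • (1 : Matrix ι ι ℝ))⁻¹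
  have h2 := sum_smul_dotProduct_mulVec_eq_trace hG
    ((G - b' • (1 : Matrix ι ι ℝ))⁻¹ * (G - b' • (1 : Matrix ι ι ℝ))⁻¹)
  have h3 := trace_inv_mul_add_smul_one hP 1 b'
  have h4 := trace_inv_mul_inv_mul_add_smul_one hP 1 b'
  rw [← hGQ] at h3 h4
  rw [h3] at h1
  rw [h4] at h2
  have hsum : ∑ j, c j * lowerShift G b' D (p j) =
      (∑ j, c j - ∑ j, c j * (p j ⬝ᵥ (G - b' • (1 : Matrix ι ι ℝ))⁻¹ *ᵥ p j)) / b' -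
      (∑ j, c j - ∑ j, c j * (p j ⬝ᵥ (G - b' • (1 : Matrix ι ι ℝ))⁻¹ *ᵥ p j) +
        b' * ∑ j, c j * (p j ⬝ᵥ ((G - b' • (1 : Matrix ι ι ℝ))⁻¹ *
          (G - b' • (1 : Matrix ι ι ℝ))⁻¹) *ᵥ p j)) / (b' ^ 2 * D) := by
    rw [Finset.mul_sum, ← Finset.sum_sub_distrib, ← Finset.sum_add_distrib, Finset.sum_div,
      Finset.sum_div, ← Finset.sum_sub_distrib]
    refine Finset.sum_congr rfl fun j _ => ?_
    rw [lowerShift]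
    ring
  rw [hsum, h1, h2, hc, lowerPotential]
  congr 1
  · field_simp
    ring
  · congr 1
    ring

theorem sum_upperShift (hc : ∑ j, c j = n) (hG : ∑ j, c j • vecMulVec (p j) (p j) = G)
    {u' : ℝ} (hu' : 0 < u') (hP : (u' • (1 : Matrix ι ι ℝ) - G).PosDef) (D : ℝ) :
    ∑ j, c j * upperShift G u' D (p j) = upperPotential n G u' +
      ((n - Fintype.card ι) + u' ^ 2 *
        ((u' • (1 : Matrix ι ι ℝ) - G)⁻¹ * (u' • (1 : Matrix ι ι ℝ) - G)⁻¹).trace) /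
        (u' ^ 2 * D) := by
  have hGQ : G = (-1 : ℝ) • (u' • (1 : Matrix ι ι ℝ) - G) + u' • (1 : Matrix ι ι ℝ) := by simp
  have h1 := sum_smul_dotProduct_mulVec_eq_trace hG (u' • (1 : Matrix ι ι ℝ) - G)⁻¹
  have h2 := sum_smul_dotProduct_mulVec_eq_trace hG
    ((u' • (1 : Matrix ι ι ℝ) - G)⁻¹ * (u' • (1 : Matrix ι ι ℝ) - G)⁻¹)
  have h3 := trace_inv_mul_add_smul_one hP (-1) u'
  have h4 := trace_inv_mul_inv_mul_add_smul_one hP (-1) u'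
  rw [← hGQ] at h3 h4
  rw [h3] at h1
  rw [h4] at h2
  have hsum : ∑ j, c j * upperShift G u' D (p j) =
      (∑ j, c j + ∑ j, c j * (p j ⬝ᵥ (u' • (1 : Matrix ι ι ℝ) - G)⁻¹ *ᵥ p j)) / u' +
      (∑ j, c j + ∑ j, c j * (p j ⬝ᵥ (u' • (1 : Matrix ι ι ℝ) - G)⁻¹ *ᵥ p j) +
        u' * ∑ j, c j * (p j ⬝ᵥ ((u' • (1 : Matrix ι ι ℝ) - G)⁻¹ *
          (u' • (1 : Matrix ι ι ℝ) - G)⁻¹) *ᵥ p j)) / (u' ^ 2 * D) := by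
    rw [Finset.mul_sum, ← Finset.sum_add_distrib, ← Finset.sum_add_distrib, Finset.sum_div,
      Finset.sum_div, ← Finset.sum_add_distrib]
    refine Finset.sum_congr rfl fun j _ => ?_
    rw [upperShift]
    ring
  rw [hsum, h1, h2, hc, upperPotential]
  congr 1
  · field_simp
    ring
  · congr 1
    ring

end Averages

section Decrease

open Matrix

variable {ι : Type*} [DecidableEq ι] {n : ℝ} {G : Matrix ι ι ℝ}

theorem posDef_sub_smul_one_mono {b b' : ℝ} (hbb : b' < b)
    (hP : (G - b • (1 : Matrix ι ι ℝ)).PosDef) : (G - b' • (1 : Matrix ι ι ℝ)).PosDef := by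
  have := hP.add (PosDef.one.smul (sub_pos.2 hbb) : ((b - b') • (1 : Matrix ι ι ℝ)).PosDef)
  rwa [show G - b • (1 : Matrix ι ι ℝ) + (b - b') • (1 : Matrix ι ι ℝ) =
      G - b' • (1 : Matrix ι ι ℝ) by rw [sub_smul]; abel] at this

theorem posDef_smul_one_sub_mono {u u' : ℝ} (huu : u < u')
    (hP : (u • (1 : Matrix ι ι ℝ) - G).PosDef) : (u' • (1 : Matrix ι ι ℝ) - G).PosDef := by
  have := hP.add (PosDef.one.smul (sub_pos.2 huu) : ((u' - u) • (1 : Matrix ι ι ℝ)).PosDef)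
  rwa [show u • (1 : Matrix ι ι ℝ) - G + (u' - u) • (1 : Matrix ι ι ℝ) =
      u' • (1 : Matrix ι ι ℝ) - G by rw [sub_smul]; abel] at this

variable [Fintype ι]

theorem lowerPotential_sub_ge {b b' : ℝ} (hb' : 0 < b') (hbb : b' < b)
    (hP : (G - b • (1 : Matrix ι ι ℝ)).PosDef) :
    (b - b') * (((G - b' • (1 : Matrix ι ι ℝ))⁻¹ * (G - b' • (1 : Matrix ι ι ℝ))⁻¹).trace +
      (n - Fintype.card ι) / (b * b')) ≤ lowerPotential n G b - lowerPotential n G b' := by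
  have h := hP.trace_inv_sub_trace_inv_add_smul_one (sub_pos.2 hbb)
  have hs : G - b • (1 : Matrix ι ι ℝ) + (b - b') • (1 : Matrix ι ι ℝ) =
      G - b' • (1 : Matrix ι ι ℝ) := by rw [sub_smul]; abel
  rw [hs] at h
  have hb : 0 < b := hb'.trans hbb
  have : (b - b') * ((n - Fintype.card ι) / (b * b')) =
      (n - Fintype.card ι) / b' - (n - Fintype.card ι) / b := by field_simp
  rw [mul_add, this, lowerPotential, lowerPotential]
  linarith

theorem upperPotential_sub_ge {u u' : ℝ} (hu : 0 < u) (huu : u < u')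
    (hP : (u • (1 : Matrix ι ι ℝ) - G).PosDef) :
    (u' - u) * (((u' • (1 : Matrix ι ι ℝ) - G)⁻¹ * (u' • (1 : Matrix ι ι ℝ) - G)⁻¹).trace +
      (n - Fintype.card ι) / (u * u')) ≤ upperPotential n G u - upperPotential n G u' := by
  have h := hP.trace_inv_sub_trace_inv_add_smul_one (sub_pos.2 huu)
  have hs : u • (1 : Matrix ι ι ℝ) - G + (u' - u) • (1 : Matrix ι ι ℝ) =
      u' • (1 : Matrix ι ι ℝ) - G := by rw [sub_smul]; abel
  rw [hs] at h
  have hu' : 0 < u' := hu.trans huu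
  have : (u' - u) * ((n - Fintype.card ι) / (u * u')) =
      (n - Fintype.card ι) / u - (n - Fintype.card ι) / u' := by field_simp
  rw [mul_add, this, upperPotential, upperPotential]
  linarith

theorem Matrix.PosDef.trace_inv_mul_inv_nonneg {Q : Matrix ι ι ℝ} (hQ : Q.PosDef) :
    0 ≤ (Q⁻¹ * Q⁻¹).trace := by
  have := (posSemidef_conjTranspose_mul_self Q⁻¹).trace_nonneg
  rwa [hQ.inv.isHermitian.eq] at this

variable {J : Type*} [Fintype J] {c : J → ℝ} {p : J → ι → ℝ}

/-- Average of the lower shifts. The hypothesis `hbn` says that the contribution of the kernel of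
`A` to the decrease of the potential is at least `1 / b'`, which is what absorbs the second-order term
coming from that kernel. -/
theorem le_sum_lowerShift (hc : ∑ j, c j = n) (hG : ∑ j, c j • vecMulVec (p j) (p j) = G)
    {b b' : ℝ} (hb' : 0 < b') (hbb : b' < b) (hP : (G - b • (1 : Matrix ι ι ℝ)).PosDef)
    (hn : (Fintype.card ι : ℝ) < n) (hbn : b ≤ (n - Fintype.card ι) * (b - b')) :
    -lowerPotential n G b - 1 / (b - b') ≤ ∑ j, c j *
      lowerShift G b' (lowerPotential n G b - lowerPotential n G b') (p j) := by
  have hP' := posDef_sub_smul_one_mono hbb hP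
  rw [sum_lowerShift hc hG hb' hP']
  have hge := lowerPotential_sub_ge (n := n) hb' hbb hP
  have hT := hP'.trace_inv_mul_inv_nonneg
  set T := ((G - b' • (1 : Matrix ι ι ℝ))⁻¹ * (G - b' • (1 : Matrix ι ι ℝ))⁻¹).trace
  set D := lowerPotential n G b - lowerPotential n G b' with hD
  set d := n - (Fintype.card ι : ℝ) with hd
  have hd0 : 0 < d := sub_pos.2 hn
  have hb : 0 < b := hb'.trans hbb
  obtain ⟨δ, hδ⟩ : ∃ δ, δ = b - b' := ⟨_, rfl⟩
  have hδ0 : 0 < δ := by linarith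
  rw [← hδ] at hge hbn ⊢
  set q := δ * (d / (b * b')) with hq
  have hq0 : 0 < q := by positivity
  have hqb : 1 / b' ≤ q := by
    rw [hq, div_le_iff₀ hb']
    have : δ * (d / (b * b')) * b' = d * δ / b := by field_simp
    rw [this, le_div_iff₀ hb]
    linarith
  have hqD : δ * T + q ≤ D := by rw [hq, ← mul_add]; exact hge
  have hqD' : q ≤ D := by nlinarith [mul_nonneg hδ0.le hT]
  have hD0 : 0 < D := by linarith
  have hdq : d / b' ^ 2 = q / δ + q / b' := by
    have : b = b' + δ := by linarith
    rw [hq, this]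
    field_simp
  have hT2 : T ≤ (D - q) / δ := by
    rw [le_div_iff₀ hδ0]; linarith
  have hqq : q / b' ≤ D * D := by
    calc q / b' = q * (1 / b') := by ring
      _ ≤ D * D := mul_le_mul hqD' (hqb.trans hqD') (by positivity) hD0.le
  have hmain : (d + b' ^ 2 * T) / (b' ^ 2 * D) ≤ D + 1 / δ := by
    have h1 : (d + b' ^ 2 * T) / (b' ^ 2 * D) = (d / b' ^ 2 + T) / D := by field_simp
    rw [h1, div_le_iff₀ hD0, hdq]
    have h2 : (D - q) / δ = D / δ - q / δ := sub_div _ _ _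
    have h3 : (D + 1 / δ) * D = D * D + D / δ := by ring
    rw [h3]
    linarith
  linarith

theorem sum_upperShift_le (hc : ∑ j, c j = n) (hG : ∑ j, c j • vecMulVec (p j) (p j) = G)
    {u u' : ℝ} (hu : 0 < u) (huu : u < u') (hP : (u • (1 : Matrix ι ι ℝ) - G).PosDef)
    (hn : (Fintype.card ι : ℝ) < n) :
    ∑ j, c j * upperShift G u' (upperPotential n G u - upperPotential n G u') (p j) ≤
      upperPotential n G u + 1 / (u' - u) := by
  have hP' := posDef_smul_one_sub_mono huu hP
  have hu' : 0 < u' := hu.trans huu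
  rw [sum_upperShift hc hG hu' hP']
  have hge := upperPotential_sub_ge (n := n) hu huu hP
  have hT := hP'.trace_inv_mul_inv_nonneg
  set T := ((u' • (1 : Matrix ι ι ℝ) - G)⁻¹ * (u' • (1 : Matrix ι ι ℝ) - G)⁻¹).trace
  set D := upperPotential n G u - upperPotential n G u' with hD
  set d := n - (Fintype.card ι : ℝ) with hd
  have hd0 : 0 < d := sub_pos.2 hn
  have hη : 0 < u' - u := sub_pos.2 huu
  have h1 : d / u' ^ 2 ≤ d / (u * u') := by
    apply div_le_div_of_nonneg_left hd0.le (by positivity)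
    nlinarith
  have h2 : (u' - u) * (T + d / u' ^ 2) ≤ D :=
    (mul_le_mul_of_nonneg_left (by linarith) hη.le).trans hge
  have hD0 : 0 < D := lt_of_lt_of_le (by positivity) h2
  have h3 : (d + u' ^ 2 * T) / (u' ^ 2 * D) = (T + d / u' ^ 2) / D := by field_simp; ring
  have h4 : (T + d / u' ^ 2) / D ≤ 1 / (u' - u) := by
    rw [div_le_div_iff₀ hD0 hη]
    linarith
  rw [h3]
  linarith

end Decrease

/-! ### Adding one vector -/

section Border

open Matrix

/-- The Gram matrix `G` of a family, bordered by the inner products `p` of its members with an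
additional unit vector. -/
def borderGram {ι : Type*} (G : Matrix ι ι ℝ) (p : ι → ℝ) : Matrix (ι ⊕ Unit) (ι ⊕ Unit) ℝ :=
  fromBlocks G (replicateCol Unit p) (replicateRow Unit p) (of fun _ _ => 1)

variable {ι : Type*} [DecidableEq ι] {n : ℝ} {G : Matrix ι ι ℝ} {p : ι → ℝ}

theorem borderGram_sub_smul_one (b : ℝ) :
    borderGram G p - b • (1 : Matrix (ι ⊕ Unit) (ι ⊕ Unit) ℝ) =
      fromBlocks (G - b • (1 : Matrix ι ι ℝ)) (replicateCol Unit p) (replicateRow Unit p)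
        (of fun _ _ => 1 - b) := by
  rw [borderGram, ← fromBlocks_one, fromBlocks_smul, sub_eq_add_neg, fromBlocks_neg,
    fromBlocks_add]
  congr 1
  · simp
  · simp
  · ext i j; simp; ring

theorem smul_one_sub_borderGram (u : ℝ) :
    u • (1 : Matrix (ι ⊕ Unit) (ι ⊕ Unit) ℝ) - borderGram G p =
      fromBlocks (u • (1 : Matrix ι ι ℝ) - G) (replicateCol Unit (-p)) (replicateRow Unit (-p))
        (of fun _ _ => u - 1) := by
  rw [borderGram, ← fromBlocks_one, fromBlocks_smul, sub_eq_add_neg, fromBlocks_neg,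
    fromBlocks_add]
  congr 1
  · ext i j; simp
  · ext i j; simp
  · ext i j; simp [sub_eq_add_neg]

variable [Fintype ι]

theorem borderGram_lower {b s : ℝ} (hP : (G - b • (1 : Matrix ι ι ℝ)).PosDef)
    (hs : 1 - b - p ⬝ᵥ (G - b • (1 : Matrix ι ι ℝ))⁻¹ *ᵥ p = s) (hs0 : 0 < s) :
    (borderGram G p - b • (1 : Matrix (ι ⊕ Unit) (ι ⊕ Unit) ℝ)).PosDef ∧
    lowerPotential n (borderGram G p) b = lowerPotential n G b + 1 / b +
      (1 + p ⬝ᵥ ((G - b • (1 : Matrix ι ι ℝ))⁻¹ * (G - b • (1 : Matrix ι ι ℝ))⁻¹) *ᵥ p) / s := by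
  have h := hP.border p (1 - b) s hs hs0
  rw [← borderGram_sub_smul_one] at h
  refine ⟨h.1, ?_⟩
  rw [lowerPotential, lowerPotential, h.2, Fintype.card_sum]
  simp
  ring

theorem borderGram_upper {u t : ℝ} (hP : (u • (1 : Matrix ι ι ℝ) - G).PosDef)
    (ht : u - 1 - p ⬝ᵥ (u • (1 : Matrix ι ι ℝ) - G)⁻¹ *ᵥ p = t) (ht0 : 0 < t) :
    (u • (1 : Matrix (ι ⊕ Unit) (ι ⊕ Unit) ℝ) - borderGram G p).PosDef ∧
    upperPotential n (borderGram G p) u = upperPotential n G u - 1 / u +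
      (1 + p ⬝ᵥ ((u • (1 : Matrix ι ι ℝ) - G)⁻¹ * (u • (1 : Matrix ι ι ℝ) - G)⁻¹) *ᵥ p) / t := by
  have h := hP.border (-p) (u - 1) t (by simpa [mulVec_neg] using ht) ht0
  rw [← smul_one_sub_borderGram] at h
  refine ⟨h.1, ?_⟩
  rw [upperPotential, upperPotential, h.2, Fintype.card_sum]
  simp [mulVec_neg]
  ring

theorem Matrix.PosDef.dotProduct_inv_mul_inv_nonneg {Q : Matrix ι ι ℝ} (hQ : Q.PosDef)
    (p : ι → ℝ) : 0 ≤ p ⬝ᵥ (Q⁻¹ * Q⁻¹) *ᵥ p := by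
  have := (posSemidef_conjTranspose_mul_self Q⁻¹).dotProduct_mulVec_nonneg p
  rwa [hQ.inv.isHermitian.eq, star_trivial] at this

theorem Matrix.PosDef.dotProduct_inv_nonneg {Q : Matrix ι ι ℝ} (hQ : Q.PosDef)
    (p : ι → ℝ) : 0 ≤ p ⬝ᵥ Q⁻¹ *ᵥ p := by
  simpa using hQ.inv.posSemidef.dotProduct_mulVec_nonneg p

/-- The hypotheses `1 / b ≤ D` and positivity of the shift replace the fact that `wᵀ(A - b)⁻²w` is
nonnegative, which is not visible from `G` and `p` alone. -/
theorem lowerShift_le_one_div {b D : ℝ} (hP : (G - b • (1 : Matrix ι ι ℝ)).PosDef) (hb : 0 < b)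
    (hD : 1 / b ≤ D) (hF : 0 < lowerShift G b D p) : lowerShift G b D p ≤ 1 / b := by
  have h1 := hP.dotProduct_inv_nonneg p
  have h2 := hP.dotProduct_inv_mul_inv_nonneg p
  rw [lowerShift] at hF ⊢
  set x := p ⬝ᵥ (G - b • (1 : Matrix ι ι ℝ))⁻¹ *ᵥ p
  set y := p ⬝ᵥ ((G - b • (1 : Matrix ι ι ℝ))⁻¹ * (G - b • (1 : Matrix ι ι ℝ))⁻¹) *ᵥ p
  have hbD : 1 ≤ b * D := by rwa [div_le_iff₀' hb] at hD
  have hD0 : 0 < D := lt_of_lt_of_le (by positivity) hD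
  have he : (1 - x) / b - (1 - x + b * y) / (b ^ 2 * D) =
      ((1 - x) * (b * D - 1) - b * y) / (b ^ 2 * D) := by field_simp; ring
  have hx : 0 < 1 - x := by
    rw [he, div_pos_iff_of_pos_right (by positivity)] at hF
    by_contra hcon
    nlinarith [mul_nonneg hb.le h2, mul_nonneg (by linarith : 0 ≤ -(1 - x))
      (by linarith : 0 ≤ b * D - 1)]
  have h3 : 0 ≤ (1 - x + b * y) / (b ^ 2 * D) := by positivity
  have h4 : (1 - x) / b ≤ 1 / b := div_le_div_of_nonneg_right (by linarith) hb.le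
  linarith

theorem borderGram_lower_of_one_le_lowerShift {b D : ℝ}
    (hP : (G - b • (1 : Matrix ι ι ℝ)).PosDef) (hb : 0 < b) (hD : 1 / b ≤ D)
    (hF : 1 ≤ lowerShift G b D p) :
    (borderGram G p - b • (1 : Matrix (ι ⊕ Unit) (ι ⊕ Unit) ℝ)).PosDef ∧
    lowerPotential n (borderGram G p) b ≤ lowerPotential n G b + D := by
  have h2 := hP.dotProduct_inv_mul_inv_nonneg p
  obtain ⟨s, hs⟩ : ∃ s, 1 - b - p ⬝ᵥ (G - b • (1 : Matrix ι ι ℝ))⁻¹ *ᵥ p = s := ⟨_, rfl⟩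
  rw [lowerShift, show 1 - p ⬝ᵥ (G - b • (1 : Matrix ι ι ℝ))⁻¹ *ᵥ p = s + b by linarith] at hF
  have hbD : 1 ≤ b * D := by rwa [div_le_iff₀' hb] at hD
  have hD0 : 0 < D := lt_of_lt_of_le (by positivity) hD
  have key : b * (1 + p ⬝ᵥ ((G - b • (1 : Matrix ι ι ℝ))⁻¹ *
      (G - b • (1 : Matrix ι ι ℝ))⁻¹) *ᵥ p) ≤ s * (b * D - 1) := by
    set y := p ⬝ᵥ ((G - b • (1 : Matrix ι ι ℝ))⁻¹ * (G - b • (1 : Matrix ι ι ℝ))⁻¹) *ᵥ p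
    have he : (s + b) / b - (s + b + b * y) / (b ^ 2 * D) =
      ((s + b) * (b * D - 1) - b * y) / (b ^ 2 * D) := by field_simp; ring
    rw [he, le_div_iff₀ (by positivity)] at hF
    nlinarith
  have hs0 : 0 < s := by
    by_contra hcon
    nlinarith [mul_nonneg (by linarith : 0 ≤ -s) (by linarith : 0 ≤ b * D - 1),
      mul_nonneg hb.le h2]
  obtain ⟨hpd, hpot⟩ := borderGram_lower (n := n) hP hs hs0
  refine ⟨hpd, ?_⟩
  rw [hpot]
  set y := p ⬝ᵥ ((G - b • (1 : Matrix ι ι ℝ))⁻¹ * (G - b • (1 : Matrix ι ι ℝ))⁻¹) *ᵥ p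
  have h3 : (1 + y) / s ≤ D - 1 / b := by
    rw [div_le_iff₀ hs0]
    have : (D - 1 / b) * s = s * (b * D - 1) / b := by field_simp
    rw [this, le_div_iff₀ hb]
    linarith
  linarith

theorem one_div_le_upperShift {u D : ℝ} (hP : (u • (1 : Matrix ι ι ℝ) - G).PosDef) (hu : 0 < u)
    (hD : 0 ≤ D) : 1 / u ≤ upperShift G u D p := by
  have h1 := hP.dotProduct_inv_nonneg p
  have h2 := hP.dotProduct_inv_mul_inv_nonneg p
  rw [upperShift]
  set x := p ⬝ᵥ (u • (1 : Matrix ι ι ℝ) - G)⁻¹ *ᵥ p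
  set y := p ⬝ᵥ ((u • (1 : Matrix ι ι ℝ) - G)⁻¹ * (u • (1 : Matrix ι ι ℝ) - G)⁻¹) *ᵥ p
  have h3 : 0 ≤ (1 + x + u * y) / (u ^ 2 * D) := by positivity
  have h4 : 1 / u ≤ (1 + x) / u := div_le_div_of_nonneg_right (by linarith) hu.le
  linarith

theorem borderGram_upper_of_upperShift_le_one {u D : ℝ}
    (hP : (u • (1 : Matrix ι ι ℝ) - G).PosDef) (hu : 0 < u) (hD : 0 < D)
    (hU : upperShift G u D p ≤ 1) :
    (u • (1 : Matrix (ι ⊕ Unit) (ι ⊕ Unit) ℝ) - borderGram G p).PosDef ∧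
    upperPotential n (borderGram G p) u ≤ upperPotential n G u + D := by
  have h1 := hP.dotProduct_inv_nonneg p
  have h2 := hP.dotProduct_inv_mul_inv_nonneg p
  obtain ⟨t, ht⟩ : ∃ t, u - 1 - p ⬝ᵥ (u • (1 : Matrix ι ι ℝ) - G)⁻¹ *ᵥ p = t := ⟨_, rfl⟩
  rw [upperShift, show 1 + p ⬝ᵥ (u • (1 : Matrix ι ι ℝ) - G)⁻¹ *ᵥ p = u - t by linarith] at hU
  have key : u * (1 + p ⬝ᵥ ((u • (1 : Matrix ι ι ℝ) - G)⁻¹ *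
      (u • (1 : Matrix ι ι ℝ) - G)⁻¹) *ᵥ p) ≤ t * (u * D + 1) := by
    set y := p ⬝ᵥ ((u • (1 : Matrix ι ι ℝ) - G)⁻¹ * (u • (1 : Matrix ι ι ℝ) - G)⁻¹) *ᵥ p
    have he : (u - t) / u + (u - t + u * y) / (u ^ 2 * D) =
      ((u - t) * (u * D + 1) + u * y) / (u ^ 2 * D) := by field_simp; ring
    rw [he, div_le_iff₀ (by positivity)] at hU
    nlinarith
  have ht0 : 0 < t := by
    have : 0 < t * (u * D + 1) := lt_of_lt_of_le (by positivity) key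
    exact pos_of_mul_pos_left this (by positivity)
  obtain ⟨hpd, hpot⟩ := borderGram_upper (n := n) hP ht ht0
  refine ⟨hpd, ?_⟩
  rw [hpot]
  set y := p ⬝ᵥ ((u • (1 : Matrix ι ι ℝ) - G)⁻¹ * (u • (1 : Matrix ι ι ℝ) - G)⁻¹) *ᵥ p
  have h3 : (1 + y) / t ≤ D + 1 / u := by
    rw [div_le_iff₀ ht0]
    have : (D + 1 / u) * t = t * (u * D + 1) / u := by field_simp
    rw [this, le_div_iff₀ hu]
    linarith
  linarith

end Border

section Step

open Matrix

/-- The spectrum of `G` lies in `(b, u)`, and the potentials of the barriers `b` and `u` are bounded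
by `-φ` and `ψ`. -/
structure IsBarrierState {ι : Type*} [Fintype ι] [DecidableEq ι] (n : ℝ) (G : Matrix ι ι ℝ)
    (b u φ ψ : ℝ) : Prop where
  lower : (G - b • (1 : Matrix ι ι ℝ)).PosDef
  upper : (u • (1 : Matrix ι ι ℝ) - G).PosDef
  lowerPotential_le : lowerPotential n G b ≤ -φ
  upperPotential_le : upperPotential n G u ≤ ψ

variable {ι J : Type*} [Fintype ι] [DecidableEq ι] [Fintype J] {n : ℝ} {G : Matrix ι ι ℝ}
  {c : J → ℝ} {p : J → ι → ℝ}

/-- Comparison of weighted averages: an index at which the lower shift dominates a multiple of the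
upper shift. -/
theorem exists_le_of_sum_mul_le_sum_mul (hc0 : ∀ j, 0 ≤ c j) (hc : 0 < ∑ j, c j) {f g : J → ℝ}
    (h : ∑ j, c j * f j ≤ ∑ j, c j * g j) : ∃ j, f j ≤ g j := by
  by_contra! hcon
  obtain ⟨j, -, hj⟩ : ∃ j ∈ Finset.univ, 0 < c j := by
    by_contra! h0
    exact absurd (Finset.sum_nonpos h0) (not_le.2 hc)
  have : ∑ j, c j * g j < ∑ j, c j * f j :=
    Finset.sum_lt_sum (fun i _ => mul_le_mul_of_nonneg_left (hcon i).le (hc0 i))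
      ⟨j, Finset.mem_univ j, mul_lt_mul_of_pos_left (hcon j) hj⟩
  linarith

/-- One step of the two-sided barrier argument. At the selected index the lower shift is at least
`β⁻¹` times the upper shift; as the former is at most `β⁻¹` and the latter at least `β`, both
barrier conditions hold there. -/
theorem IsBarrierState.exists_step {b b' u u' φ ψ β : ℝ} (h : IsBarrierState n G b u φ ψ)
    (hc0 : ∀ j, 0 ≤ c j) (hc : ∑ j, c j = n) (hG : ∑ j, c j • vecMulVec (p j) (p j) = G)
    (hn : (Fintype.card ι : ℝ) < n) (hβ : 0 < β) (hβb : β ≤ b') (hbb : b' < b)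
    (hbn : b ≤ (n - Fintype.card ι) * (b - b')) (hu : 0 < u) (huu : u < u') (huβ : u' ≤ 1 / β)
    (havg : (1 / β) * (ψ + 1 / (u' - u)) ≤ φ - 1 / (b - b')) :
    ∃ j, IsBarrierState n (borderGram G (p j)) b' u' φ ψ := by
  have hb' : 0 < b' := hβ.trans_le hβb
  have hb : 0 < b := hb'.trans hbb
  have hu' : 0 < u' := hu.trans huu
  have hd : 0 < n - (Fintype.card ι : ℝ) := sub_pos.2 hn
  have hn0 : 0 < n := lt_of_le_of_lt (Nat.cast_nonneg _) hn
  have hP' := posDef_sub_smul_one_mono hbb h.lower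
  have hQ' := posDef_smul_one_sub_mono huu h.upper
  have hF := le_sum_lowerShift hc hG hb' hbb h.lower hn hbn
  have hU := sum_upperShift_le hc hG hu huu h.upper hn
  have hDl : 1 / b' ≤ lowerPotential n G b - lowerPotential n G b' := by
    refine le_trans ?_ (lowerPotential_sub_ge hb' hbb h.lower)
    have h1 := mul_nonneg (sub_pos.2 hbb).le hP'.trace_inv_mul_inv_nonneg
    have h2 : 1 / b' ≤ (b - b') * ((n - Fintype.card ι) / (b * b')) := by
      rw [div_le_iff₀ hb']
      have : (b - b') * ((n - Fintype.card ι) / (b * b')) * b' =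
        (n - Fintype.card ι) * (b - b') / b := by field_simp
      rw [this, le_div_iff₀ hb]
      linarith
    rw [mul_add]
    linarith
  have hDu : 0 < upperPotential n G u - upperPotential n G u' := by
    refine lt_of_lt_of_le ?_ (upperPotential_sub_ge hu huu h.upper)
    have h1 := hQ'.trace_inv_mul_inv_nonneg
    have h2 : 0 < (n - (Fintype.card ι : ℝ)) / (u * u') := by positivity
    exact mul_pos (sub_pos.2 huu) (by linarith)
  set Dl := lowerPotential n G b - lowerPotential n G b'
  set Du := upperPotential n G u - upperPotential n G u'
  obtain ⟨j, hj⟩ : ∃ j, (1 / β) * upperShift G u' Du (p j) ≤ lowerShift G b' Dl (p j) := by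
    refine exists_le_of_sum_mul_le_sum_mul hc0 (hc ▸ hn0) ?_
    calc ∑ j, c j * (1 / β * upperShift G u' Du (p j))
        = 1 / β * ∑ j, c j * upperShift G u' Du (p j) := by
          rw [Finset.mul_sum]; exact Finset.sum_congr rfl fun _ _ => by ring
      _ ≤ 1 / β * (ψ + 1 / (u' - u)) := by
          refine mul_le_mul_of_nonneg_left (hU.trans ?_) (by positivity)
          linarith [h.upperPotential_le]
      _ ≤ φ - 1 / (b - b') := havg
      _ ≤ _ := by linarith [h.lowerPotential_le]
  have hUge : 1 / u' ≤ upperShift G u' Du (p j) := one_div_le_upperShift hQ' hu' hDu.le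
  have hβu : β ≤ 1 / u' := by rwa [le_one_div hβ hu']
  have hF1 : 1 ≤ lowerShift G b' Dl (p j) := by
    refine le_trans ?_ hj
    rw [one_div, ← div_eq_inv_mul, le_div_iff₀ hβ]
    linarith
  have hFle : lowerShift G b' Dl (p j) ≤ 1 / b' :=
    lowerShift_le_one_div hP' hb' hDl (by linarith)
  have hU1 : upperShift G u' Du (p j) ≤ 1 := by
    have h1 : 1 / β * upperShift G u' Du (p j) ≤ 1 / β * 1 := by
      rw [mul_one]
      exact hj.trans (hFle.trans (one_div_le_one_div_of_le hβ hβb))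
    exact le_of_mul_le_mul_left h1 (by positivity)
  obtain ⟨hl, hl'⟩ := borderGram_lower_of_one_le_lowerShift (n := n) hP' hb' hDl hF1
  obtain ⟨hr, hr'⟩ := borderGram_upper_of_upperShift_le_one (n := n) hQ' hu' hDu hU1
  exact ⟨j, hl, hr, by linarith [h.lowerPotential_le], by linarith [h.upperPotential_le]⟩

/-- The last vector can be added with no need to control the potentials afterwards, so that
the terms involving the decrease of the potentials disappear. They vanish in `lowerShift` and
`upperShift` at `D = 0`, division by zero being zero. -/
theorem IsBarrierState.exists_last_step {b u φ ψ β : ℝ} (h : IsBarrierState n G b u φ ψ)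
    (hc0 : ∀ j, 0 ≤ c j) (hc : ∑ j, c j = n) (hG : ∑ j, c j • vecMulVec (p j) (p j) = G)
    (hn : (Fintype.card ι : ℝ) < n) (hβ : 0 < β) (hβb : β < b) (hu : 0 < u) (huβ : u < 1 / β)
    (havg : (1 / β) * ψ < φ) :
    ∃ j, (borderGram G (p j) - β • (1 : Matrix (ι ⊕ Unit) (ι ⊕ Unit) ℝ)).PosDef ∧
      ((1 / β) • (1 : Matrix (ι ⊕ Unit) (ι ⊕ Unit) ℝ) - borderGram G (p j)).PosDef := by
  have hd : 0 < n - (Fintype.card ι : ℝ) := sub_pos.2 hn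
  have hn0 : 0 < n := lt_of_le_of_lt (Nat.cast_nonneg _) hn
  have hβ' : 0 < 1 / β := by positivity
  have hP' := posDef_sub_smul_one_mono hβb h.lower
  have hQ' := posDef_smul_one_sub_mono huβ h.upper
  have hF := sum_lowerShift hc hG hβ hP' 0
  have hU := sum_upperShift hc hG hβ' hQ' 0
  have hDl : lowerPotential n G β ≤ lowerPotential n G b := by
    have h1 := lowerPotential_sub_ge (n := n) hβ hβb h.lower
    have h2 := hP'.trace_inv_mul_inv_nonneg
    have h3 : 0 < (n - (Fintype.card ι : ℝ)) / (b * β) := by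
      have := hβ.trans hβb; positivity
    have := mul_nonneg (sub_pos.2 hβb).le (add_nonneg h2 h3.le)
    linarith
  have hDu : upperPotential n G (1 / β) ≤ upperPotential n G u := by
    have h1 := upperPotential_sub_ge (n := n) hu huβ h.upper
    have h2 := hQ'.trace_inv_mul_inv_nonneg
    have h3 : 0 < (n - (Fintype.card ι : ℝ)) / (u * (1 / β)) := by positivity
    have := mul_nonneg (sub_pos.2 huβ).le (add_nonneg h2 h3.le)
    linarith
  rw [mul_zero, div_zero, sub_zero] at hF
  rw [mul_zero, div_zero, add_zero] at hU
  obtain ⟨j, hj⟩ : ∃ j, (1 / β) * upperShift G (1 / β) 0 (p j) + (φ - (1 / β) * ψ) / n ≤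
      lowerShift G β 0 (p j) := by
    refine exists_le_of_sum_mul_le_sum_mul hc0 (hc ▸ hn0) ?_
    calc ∑ j, c j * (1 / β * upperShift G (1 / β) 0 (p j) + (φ - (1 / β) * ψ) / n)
        = 1 / β * ∑ j, c j * upperShift G (1 / β) 0 (p j) +
            (∑ j, c j) * ((φ - (1 / β) * ψ) / n) := by
          rw [Finset.mul_sum, Finset.sum_mul, ← Finset.sum_add_distrib]
          exact Finset.sum_congr rfl fun _ _ => by ring
      _ ≤ 1 / β * ψ + n * ((φ - (1 / β) * ψ) / n) := by
          rw [hU, hc]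
          have := mul_le_mul_of_nonneg_left (hDu.trans h.upperPotential_le) hβ'.le
          linarith
      _ = φ := by rw [mul_div_cancel₀ _ hn0.ne']; ring
      _ ≤ _ := by rw [hF]; linarith [h.lowerPotential_le]
  have hslack : 0 < (φ - (1 / β) * ψ) / n := div_pos (by linarith) hn0
  have h1 := hP'.dotProduct_inv_nonneg (p j)
  have h2 := hQ'.dotProduct_inv_nonneg (p j)
  rw [lowerShift, upperShift] at hj
  simp only [mul_zero, div_zero, sub_zero, add_zero] at hj
  obtain ⟨s, hs⟩ : ∃ s, 1 - β - p j ⬝ᵥ (G - β • (1 : Matrix ι ι ℝ))⁻¹ *ᵥ p j = s := ⟨_, rfl⟩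
  obtain ⟨t, ht⟩ : ∃ t, 1 / β - 1 - p j ⬝ᵥ ((1 / β) • (1 : Matrix ι ι ℝ) - G)⁻¹ *ᵥ p j = t :=
    ⟨_, rfl⟩
  set x := p j ⬝ᵥ (G - β • (1 : Matrix ι ι ℝ))⁻¹ *ᵥ p j
  set y := p j ⬝ᵥ ((1 / β) • (1 : Matrix ι ι ℝ) - G)⁻¹ *ᵥ p j
  have hj' : 1 + y < (1 - x) / β := by
    have : 1 / β * ((1 + y) / (1 / β)) = 1 + y := by field_simp
    linarith
  rw [lt_div_iff₀ hβ] at hj'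
  have hs0 : 0 < s := by nlinarith
  have ht0 : 0 < t := by
    have : 1 + y < 1 / β := by
      rw [lt_div_iff₀ hβ]; linarith
    linarith
  exact ⟨j, (borderGram_lower (n := n) hP' hs hs0).1, (borderGram_upper (n := n) hQ' ht ht0).1⟩

end Step

/-! ### Iterating the barrier step -/

section Iterate

open Matrix

variable {E : Type*} [NormedAddCommGroup E] [InnerProductSpace ℝ E]

theorem gram_sumElim_eq_borderGram {ι : Type*} (x : ι → E) {w : E} (hw : ‖w‖ = 1) :
    gram ℝ (Sum.elim x fun _ : Unit => w) = borderGram (gram ℝ x) fun i => ⟪x i, w⟫ := by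
  ext i j
  rcases i with i | i <;> rcases j with j | j <;>
    simp [borderGram, gram_apply, real_inner_comm, hw]

theorem sum_smul_vecMulVec_inner_eq_gram {ι J : Type*} [Fintype J] {c : J → ℝ} {v : J → E}
    (hid : ∀ x y, ∑ j, c j * (⟪x, v j⟫ * ⟪v j, y⟫) = ⟪x, y⟫) (x : ι → E) :
    ∑ j, c j • vecMulVec (fun i => ⟪x i, v j⟫) (fun i => ⟪x i, v j⟫) = gram ℝ x := by
  ext i k
  rw [gram_apply, ← hid, Matrix.sum_apply]
  refine Finset.sum_congr rfl fun j _ => ?_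
  rw [Matrix.smul_apply, vecMulVec_apply, smul_eq_mul, real_inner_comm (v j) (x k)]

/-- `l` barrier steps, for a lower barrier moving from `b₀` by steps `δ` and an upper barrier moving
from `u₀` by steps `η`. -/
theorem exists_isBarrierState {J : Type} [Fintype J] {n : ℝ} {c : J → ℝ} {v : J → E}
    (hc0 : ∀ j, 0 ≤ c j) (hc : ∑ j, c j = n) (hv : ∀ j, ‖v j‖ = 1)
    (hid : ∀ x y, ∑ j, c j * (⟪x, v j⟫ * ⟪v j, y⟫) = ⟪x, y⟫)
    {β b₀ δ u₀ η : ℝ} (hβ : 0 < β) (hδ : 0 < δ) (hη : 0 < η) (hu₀ : 0 < u₀)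
    (hb₀ : b₀ ≤ n * δ) (havg : (1 / β) * (n / u₀ + 1 / η) ≤ n / b₀ - 1 / δ) (l : ℕ)
    (hln : (l : ℝ) ≤ n) (hbl : β ≤ b₀ - l * δ) (hul : u₀ + l * η ≤ 1 / β) :
    ∃ (ι : Type) (_ : Fintype ι) (_ : DecidableEq ι) (x : ι → J), Fintype.card ι = l ∧
      IsBarrierState n (gram ℝ fun i => v (x i)) (b₀ - l * δ) (u₀ + l * η) (n / b₀) (n / u₀) := by
  induction l with
  | zero =>
    refine ⟨Empty, inferInstance, inferInstance, Empty.elim, by simp, ?_⟩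
    have hpd : ∀ A : Matrix Empty Empty ℝ, A.PosDef := fun A =>
      PosDef.of_dotProduct_mulVec_pos (Subsingleton.elim _ _)
        fun x hx => absurd (Subsingleton.elim x 0) hx
    refine ⟨hpd _, hpd _, ?_, ?_⟩
    · simp [lowerPotential, Matrix.trace]
    · simp [upperPotential, Matrix.trace]
  | succ l ih =>
    push_cast at hln hbl hul ⊢
    obtain ⟨ι, _, _, x, hcard, hst⟩ := ih (by linarith) (by linarith) (by linarith)
    obtain ⟨j, hj⟩ := hst.exists_step (b' := b₀ - (l + 1) * δ) (u' := u₀ + (l + 1) * η)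
      hc0 hc (sum_smul_vecMulVec_inner_eq_gram hid fun i => v (x i)) (by rw [hcard]; linarith) hβ
      hbl (by linarith) (by rw [hcard]; linarith) (by positivity) (by linarith) hul
      (by rw [show u₀ + (l + 1) * η - (u₀ + l * η) = η by ring,
            show b₀ - l * δ - (b₀ - (l + 1) * δ) = δ by ring]; exact havg)
    refine ⟨ι ⊕ Unit, inferInstance, inferInstance, Sum.elim x fun _ => j, by simp [hcard], ?_⟩
    rw [← gram_sumElim_eq_borderGram _ (hv j)] at hj
    have : (fun i => v (Sum.elim x (fun _ : Unit => j) i)) =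
        Sum.elim (fun i => v (x i)) fun _ => v j := by
      ext i; rcases i with i | i <;> rfl
    rw [this]
    exact hj

theorem dotProduct_gram_mulVec_eq_norm_sq {ι : Type*} [Fintype ι] (x : ι → E) (a : ι → ℝ) :
    a ⬝ᵥ gram ℝ x *ᵥ a = ‖∑ i, a i • x i‖ ^ 2 := by
  have := star_dotProduct_gram_mulVec (𝕜 := ℝ) x a a
  rw [star_trivial] at this
  rw [this, real_inner_self_eq_norm_sq]

theorem sum_sq_le_of_posDef_gram {ι : Type*} [Fintype ι] [DecidableEq ι] {x : ι → E}
    {b u : ℝ} (hb : (gram ℝ x - b • (1 : Matrix ι ι ℝ)).PosDef)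
    (hu : (u • (1 : Matrix ι ι ℝ) - gram ℝ x).PosDef) (a : ι → ℝ) :
    b * ∑ i, a i ^ 2 ≤ ‖∑ i, a i • x i‖ ^ 2 ∧ ‖∑ i, a i • x i‖ ^ 2 ≤ u * ∑ i, a i ^ 2 := by
  have h0 : a ⬝ᵥ a = ∑ i, a i ^ 2 := by simp [dotProduct, sq]
  have h1 := hb.posSemidef.dotProduct_mulVec_nonneg a
  have h2 := hu.posSemidef.dotProduct_mulVec_nonneg a
  simp only [star_trivial, sub_mulVec, smul_mulVec, one_mulVec, dotProduct_sub, dotProduct_smul,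
    smul_eq_mul, h0, dotProduct_gram_mulVec_eq_norm_sq] at h1 h2
  constructor <;> linarith

/-- Two-sided restricted invertibility for a decomposition of the identity over unit vectors. -/
theorem exists_restricted_invertibility {J : Type} [Fintype J] {n : ℝ} {c : J → ℝ} {v : J → E}
    (hn : 0 < n) (hc0 : ∀ j, 0 ≤ c j) (hc : ∑ j, c j = n) (hv : ∀ j, ‖v j‖ = 1)
    (hid : ∀ x y, ∑ j, c j * (⟪x, v j⟫ * ⟪v j, y⟫) = ⟪x, y⟫)
    {ε : ℝ} (hε0 : 0 < ε) (hε1 : ε < 1) :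
    ∃ (k : ℕ) (x : Fin k → J), (1 - ε) ^ 2 * n ≤ k ∧ ∀ a : Fin k → ℝ,
      (ε / (2 - ε)) ^ 2 * ∑ j, a j ^ 2 ≤ ‖∑ j, a j • v (x j)‖ ^ 2 ∧
      ‖∑ j, a j • v (x j)‖ ^ 2 ≤ ((2 - ε) / ε) ^ 2 * ∑ j, a j ^ 2 := by
  have h1 : 0 < 1 - ε := by linarith
  have h2 : 0 < 2 - ε := by linarith
  have hκ : 0 < (1 - ε) ^ 2 * n := by positivity
  obtain ⟨l, hl⟩ : ∃ l, ⌈(1 - ε) ^ 2 * n⌉₊ = l + 1 :=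
    Nat.exists_eq_succ_of_ne_zero (Nat.ceil_pos.2 hκ).ne'
  have hlκ : (l : ℝ) < (1 - ε) ^ 2 * n := Nat.lt_ceil.1 (by omega)
  have hln : (l : ℝ) < n :=
    hlκ.trans_le (mul_le_of_le_one_left hn.le (pow_le_one₀ h1.le (by linarith)))
  -- The constants: after `(1 - ε)² n` steps the barriers would be exactly at `β` and `1 / β`, and
  -- `b₀`, `u₀` are optimal under this constraint.
  set β := (ε / (2 - ε)) ^ 2 with hβdef
  set b₀ := ε / (2 - ε) ^ 2 with hb₀def
  set δ := b₀ / ((1 - ε) * n) with hδdef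
  set u₀ := (2 - ε) / ε ^ 2 with hu₀def
  set η := u₀ / ((1 - ε) * n) with hηdef
  have hβ : 0 < β := by positivity
  have hb₀ : 0 < b₀ := by positivity
  have hδ : 0 < δ := by positivity
  have hu₀ : 0 < u₀ := by positivity
  have hη : 0 < η := by positivity
  have hβ1 : 1 / β = ((2 - ε) / ε) ^ 2 := by rw [hβdef]; field_simp
  have hbend : b₀ - (1 - ε) ^ 2 * n * δ = β := by
    rw [hδdef, hβdef, hb₀def]; field_simp; ring
  have huend : u₀ + (1 - ε) ^ 2 * n * η = 1 / β := by
    rw [hβ1, hηdef, hu₀def]; field_simp; ring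
  have hbl : β < b₀ - l * δ := by
    have := mul_lt_mul_of_pos_right hlκ hδ
    linarith
  have hul : u₀ + l * η < 1 / β := by
    have := mul_lt_mul_of_pos_right hlκ hη
    linarith
  have hbn : b₀ ≤ n * δ := by
    have : n * δ = b₀ / (1 - ε) := by rw [hδdef]; field_simp
    rw [this, le_div_iff₀ h1]
    nlinarith
  have havg : (1 / β) * (n / u₀ + 1 / η) = n / b₀ - 1 / δ := by
    rw [hβ1, hηdef, hδdef, hu₀def, hb₀def]; field_simp; ring
  have hlast : (1 / β) * (n / u₀) < n / b₀ := by
    have e1 : (1 / β) * (n / u₀) = n * (2 - ε) := by rw [hβ1, hu₀def]; field_simp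
    have e2 : n / b₀ = n * (2 - ε) * ((2 - ε) / ε) := by rw [hb₀def]; field_simp
    have e3 : 1 < (2 - ε) / ε := by rw [lt_div_iff₀ hε0]; linarith
    rw [e1, e2]
    exact lt_mul_of_one_lt_right (by positivity) e3
  obtain ⟨ι, _, _, x, hcard, hst⟩ := exists_isBarrierState hc0 hc hv hid hβ hδ hη hu₀ hbn
    havg.le l hln.le hbl.le hul.le
  obtain ⟨j, hj1, hj2⟩ := hst.exists_last_step hc0 hc
    (sum_smul_vecMulVec_inner_eq_gram hid fun i => v (x i)) (by rw [hcard]; exact hln) hβ hbl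
    (by positivity) hul hlast
  rw [← gram_sumElim_eq_borderGram _ (hv j)] at hj1 hj2
  have hcard' : Fintype.card (ι ⊕ Unit) = l + 1 := by simp [hcard]
  let e : ι ⊕ Unit ≃ Fin (l + 1) := Fintype.equivFinOfCardEq hcard'
  refine ⟨l + 1, Sum.elim x (fun _ => j) ∘ e.symm, ?_, fun a => ?_⟩
  · rw [← hl]; exact Nat.le_ceil _
  · have h := sum_sq_le_of_posDef_gram hj1 hj2 (a ∘ e)
    have hs1 : ∑ i, (a ∘ e) i ^ 2 = ∑ i, a i ^ 2 := e.sum_comp fun i => a i ^ 2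
    have hs2 : ∑ i, (a ∘ e) i • (Sum.elim (fun i => v (x i)) (fun _ => v j)) i =
        ∑ i, a i • v ((Sum.elim x (fun _ => j) ∘ e.symm) i) := by
      rw [← e.sum_comp]
      refine Finset.sum_congr rfl fun i _ => ?_
      rcases i with i | i <;> simp
    rw [hs1, hs2, hβ1] at h
    exact h

end Iterate

/-! ### The factorization -/

/-- The factorization through `β z = (⟪x j, z⟫)ⱼ`, whose norm is at most one because contact points
are norming functionals, and `α = X (XᵀX)⁻¹`, where `X a = ∑ j, a j • x j`. -/
theorem hasDvoretzkyRogersFactorization_of_contactPoints {n k : ℕ}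
    {N : Seminorm ℝ (EuclideanSpace ℝ (Fin n))} (hN : ∀ x, N x ≤ ‖x‖)
    {x : Fin k → EuclideanSpace ℝ (Fin n)} (hx : ∀ j, IsContactPoint N (x j)) {C : ℝ} (hC : 0 < C)
    (hlow : ∀ a : Fin k → ℝ, Real.sqrt (∑ j, a j ^ 2) ≤ C * ‖∑ j, a j • x j‖) :
    HasDvoretzkyRogersFactorization N k C := by
  let X : (Fin k → ℝ) →ₗ[ℝ] EuclideanSpace ℝ (Fin n) := Fintype.linearCombination ℝ x
  let B : EuclideanSpace ℝ (Fin n) →ₗ[ℝ] (Fin k → ℝ) := LinearMap.pi fun j => innerₛₗ ℝ (x j)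
  have hX : ∀ a, X a = ∑ j, a j • x j := fun a => Fintype.linearCombination_apply ℝ x a
  have hB : ∀ z j, B z j = ⟪x j, z⟫ := fun z j => rfl
  have hnorm : ∀ a, ‖X a‖ ^ 2 = ∑ j, a j * B (X a) j := by
    intro a
    rw [← real_inner_self_eq_norm_sq]
    conv_lhs => rw [hX a, sum_inner]
    refine Finset.sum_congr rfl fun j _ => ?_
    rw [real_inner_smul_left, hB, ← hX a]
  have hinj : Function.Injective (B ∘ₗ X) := by
    rw [← LinearMap.ker_eq_bot, LinearMap.ker_eq_bot']
    intro a ha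
    have h1 : ‖X a‖ ^ 2 = 0 := by
      have : B (X a) = 0 := ha
      rw [hnorm, this]
      simp
    have h2 := hlow a
    rw [← hX, pow_eq_zero_iff two_ne_zero |>.1 h1, mul_zero] at h2
    have h3 := Real.sqrt_eq_zero'.1 (le_antisymm h2 (Real.sqrt_nonneg _))
    ext j
    have := (Finset.single_le_sum (f := fun j => a j ^ 2) (fun i _ => sq_nonneg _)
      (Finset.mem_univ j)).trans h3
    simpa using le_antisymm this (sq_nonneg _)
  let e : (Fin k → ℝ) ≃ₗ[ℝ] (Fin k → ℝ) := LinearEquiv.ofInjectiveEndo (B ∘ₗ X) hinj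
  have he : ∀ a, B (X (e.symm a)) = a := fun a => e.apply_symm_apply a
  refine ⟨X ∘ₗ e.symm.toLinearMap ∘ₗ (WithLp.linearEquiv 2 ℝ (Fin k → ℝ)).toLinearMap, B,
    ?_, ?_, ?_⟩
  · intro a j
    exact congrFun (he a.ofLp) j
  · intro a
    refine (hN _).trans ?_
    change ‖X (e.symm a.ofLp)‖ ≤ C * ‖a‖
    set b := e.symm a.ofLp with hb
    have h1 : ‖X b‖ ^ 2 = ∑ j, b j * a j := by rw [hnorm, he]
    have h2 : ∑ j, b j * a j ≤ Real.sqrt (∑ j, b j ^ 2) * ‖a‖ := by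
      rw [EuclideanSpace.norm_eq]
      simpa using Real.sum_mul_le_sqrt_mul_sqrt Finset.univ b a
    have h3 := hlow b
    rw [← hX] at h3
    have h4 : ‖X b‖ * ‖X b‖ ≤ (C * ‖a‖) * ‖X b‖ := by
      calc ‖X b‖ * ‖X b‖ = ∑ j, b j * a j := by rw [← h1]; ring
        _ ≤ (C * ‖X b‖) * ‖a‖ := h2.trans (mul_le_mul_of_nonneg_right h3 (norm_nonneg _))
        _ = _ := by ring
    rcases (norm_nonneg (X b)).eq_or_lt with h0 | h0
    · rw [← h0]; positivity
    · exact le_of_mul_le_mul_right h4 h0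
  · intro z
    rw [pi_norm_le_iff_of_nonneg (apply_nonneg N z)]
    intro j
    rw [hB, Real.norm_eq_abs]
    exact (hx j).abs_inner_le hN z

theorem mainTheorem2 (n : ℕ) (N : Seminorm ℝ (EuclideanSpace ℝ (Fin n)))
    (hN : ∀ x, N x = 0 → x = 0)
    (hJohn : IsMaxVolumeEllipsoid (Metric.closedBall 0 1) (N.closedBall 0 1))
    (ε : ℝ) (hε0 : 0 < ε) (hε1 : ε < 1) :
    ∃ (k : ℕ) (x : Fin k → EuclideanSpace ℝ (Fin n)),
      (1 - ε) ^ 2 * (n : ℝ) ≤ (k : ℝ) ∧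
      (∀ j, IsContactPoint N (x j)) ∧
      (∀ a : Fin k → ℝ,
        ε / (2 - ε) * Real.sqrt (∑ j, a j ^ 2) ≤ ‖∑ j, a j • x j‖ ∧
        ‖∑ j, a j • x j‖ ≤ (2 - ε) / ε * Real.sqrt (∑ j, a j ^ 2)) ∧
      HasDvoretzkyRogersFactorization N k ((2 - ε) / ε) := by
  have h2 : 0 < 2 - ε := by linarith
  have hle := N.le_norm_of_closedBall_subset hJohn.2.1
  suffices h : ∃ (k : ℕ) (x : Fin k → EuclideanSpace ℝ (Fin n)),
      (1 - ε) ^ 2 * (n : ℝ) ≤ (k : ℝ) ∧ (∀ j, IsContactPoint N (x j)) ∧ ∀ a : Fin k → ℝ,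
        (ε / (2 - ε)) ^ 2 * ∑ j, a j ^ 2 ≤ ‖∑ j, a j • x j‖ ^ 2 ∧
        ‖∑ j, a j • x j‖ ^ 2 ≤ ((2 - ε) / ε) ^ 2 * ∑ j, a j ^ 2 by
    obtain ⟨k, x, hk, hx, hbd⟩ := h
    have hbd' : ∀ a : Fin k → ℝ,
        ε / (2 - ε) * Real.sqrt (∑ j, a j ^ 2) ≤ ‖∑ j, a j • x j‖ ∧
        ‖∑ j, a j • x j‖ ≤ (2 - ε) / ε * Real.sqrt (∑ j, a j ^ 2) := by
      intro a
      have hs : Real.sqrt (∑ j, a j ^ 2) ^ 2 = ∑ j, a j ^ 2 :=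
        Real.sq_sqrt (Finset.sum_nonneg fun _ _ => sq_nonneg _)
      obtain ⟨hl, hu⟩ := hbd a
      rw [← hs, ← mul_pow] at hl hu
      exact ⟨(pow_le_pow_iff_left₀ (by positivity) (by positivity) two_ne_zero).1 hl,
        (pow_le_pow_iff_left₀ (by positivity) (by positivity) two_ne_zero).1 hu⟩
    refine ⟨k, x, hk, hx, hbd', hasDvoretzkyRogersFactorization_of_contactPoints hle hx
      (by positivity) fun a => ?_⟩
    have h := mul_le_mul_of_nonneg_left (hbd' a).1 (by positivity : 0 ≤ (2 - ε) / ε)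
    rwa [← mul_assoc, show (2 - ε) / ε * (ε / (2 - ε)) = 1 by field_simp, one_mul] at h
  rcases Nat.eq_zero_or_pos n with rfl | hn
  · exact ⟨0, Fin.elim0, by simp, fun j => j.elim0, fun a => by simp⟩
  obtain ⟨J, _, c, v, hc0, hv, hc, hid⟩ := hJohn.exists_decomposition hn
  obtain ⟨k, x, hk, hbd⟩ := exists_restricted_invertibility (by exact_mod_cast hn) hc0 hc
    (fun j => (hv j).2) hid hε0 hε1
  exact ⟨k, fun j => v (x j), hk, fun j => hv (x j), hbd⟩
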